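/- Let $n\in\mathbb N$. For $k,l\in\mathbb Z^n$ the twisted translation on $L^2(\mathbb R^{2n})$ is $T^t_{(k,l)}\varphi(x,y)=e^{\pi i(x\cdot l-y\cdot k)}\varphi(x-k,y-l)$. For $\varphi\in L^2(\mathbb R^{2n})$ put $E^t(\varphi)=\{T^t_{(k,l)}\varphi: k,l\in\mathbb Z^n\}$ and $V^t(\varphi)=\overline{\operatorname{span}}\,E^t(\varphi)$. Let $\varphi\mapsto K_\varphi$ be the continuous extension to $L^2(\mathbb R^{2n})$ of the map defined on $L^1\cap L^2(\mathbb R^{2n})$ by $K_g(\xi,\eta)=\int_{\mathbb R^n} g(x,\eta-\xi)\,e^{\pi i x\cdot(\xi+\eta)}\,dx$ (the kernel of the Weyl transform). The Weyl–Zak transform of $\varphi$ is $$Z_W\varphi(\xi,\xi',\eta)=\sum_{m\in\mathbb Z^n}K_\varphi(m+\xi,\eta)\,e^{-2\pi i m\cdot\xi'},\qquad \xi,\xi'\in\mathbb T^n=[0,1)^n,\ \eta\in\mathbb R^n,$$ with convergence in $L^2(\mathbb T^n\times\mathbb T^n\times\mathbb R^n)$. Put $\mathcal J\varphi(\xi,\xi')=Z_W\varphi(\xi,\xi',\cdot)\in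 L^2(\mathbb R^n)$ for a.e. $(\xi,\xi')$, and $[\varphi,\varphi](\xi,\xi')=\int_{\mathbb R^n}|Z_W\varphi(\xi,\xi',\eta)|^2\,d\eta$. **Theorem.** Let $\varphi\in L^2(\mathbb R^{2n})$. Then $E^t(\varphi)$ is a Parseval frame for $V^t(\varphi)$, that is, $\sum_{k,l\in\mathbb Z^n}|\langle f,T^t_{(k,l)}\varphi\rangle|^2=\|f\|^2$ for all $f\in V^t(\varphi)$, if and only if $\|\mathcal J\varphi(\xi,\xi')\|_{L^2(\mathbb R^n)}=1$ for almost every $(\xi,\xi')\in\Omega_\varphi$, where $\Omega_\varphi=\{(\xi,\xi')\in\mathbb T^n\times\mathbb T^n:[\varphi,\varphi](\xi,\xi')\neq0\}$. -/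

import Mathlib

open MeasureTheory
open scoped FourierTransform ENNReal ComplexConjugate

noncomputable section

namespace TwistedShift

/-- The Euclidean space `ℝⁿ`. -/
abbrev Rn (n : ℕ) : Type := EuclideanSpace ℝ (Fin n)

/-- The Hilbert space `L²(ℝ²ⁿ)`, with `ℝ²ⁿ = ℝⁿ × ℝⁿ` and Lebesgue measure. -/
abbrev L2R2n (n : ℕ) : Type := Lp ℂ 2 (volume : Measure (Rn n × Rn n))

/-- The inclusion `ℤⁿ ⊆ ℝⁿ`. -/
def intVec {n : ℕ} (k : Fin n → ℤ) : Rn n := WithLp.toLp 2 (fun i => (k i : ℝ))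

/-! ### Parseval frames -/

/-- The family `f` is a frame for the subspace `V`, with frame bounds `A` and `B`. -/
def IsFrameWithBounds {ι H : Type*} [NormedAddCommGroup H] [InnerProductSpace ℂ H]
    (A B : ℝ) (V : Submodule ℂ H) (f : ι → H) : Prop :=
  0 < A ∧ 0 < B ∧ (∀ i, f i ∈ V) ∧ ∀ g ∈ V,
    Summable (fun i => ‖inner ℂ (f i) g‖ ^ 2) ∧
    A * ‖g‖ ^ 2 ≤ ∑' i, ‖inner ℂ (f i) g‖ ^ 2 ∧
    ∑' i, ‖inner ℂ (f i) g‖ ^ 2 ≤ B * ‖g‖ ^ 2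

/-- A Parseval frame for `V` is a frame for `V` with bounds `A = B = 1`. -/
def IsParsevalFrame {ι H : Type*} [NormedAddCommGroup H] [InnerProductSpace ℂ H]
    (V : Submodule ℂ H) (f : ι → H) : Prop :=
  IsFrameWithBounds 1 1 V f

/-! ### Twisted translations -/

/-- `e^{πi(x·l - y·k)} φ(x - k, y - l)`. -/
def twistedTranslateFun {n : ℕ} (k l : Fin n → ℤ) (φ : Rn n × Rn n → ℂ) (p : Rn n × Rn n) : ℂ :=
  Complex.exp (Real.pi * Complex.I *
      ((inner ℝ p.1 (intVec l) - inner ℝ p.2 (intVec k) : ℝ) : ℂ)) *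
    φ (p.1 - intVec k, p.2 - intVec l)

theorem norm_exp_pi_mul_I (t : ℝ) : ‖Complex.exp (Real.pi * Complex.I * (t : ℂ))‖ = 1 := by
  rw [show (Real.pi * Complex.I * (t : ℂ)) = ((Real.pi * t : ℝ) : ℂ) * Complex.I by
    push_cast; ring]
  exact Complex.norm_exp_ofReal_mul_I _

theorem memLp_twistedTranslateFun {n : ℕ} (k l : Fin n → ℤ) (φ : L2R2n n) :
    MemLp (twistedTranslateFun k l φ) 2 volume := by
  have h1 : MemLp (fun p : Rn n × Rn n => φ (p - (intVec k, intVec l))) 2 volume :=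
    (Lp.memLp φ).comp_measurePreserving 
      ((measurePreserving_sub_right volume (intVec k)).prod
        (measurePreserving_sub_right volume (intVec l)))
  refine MemLp.of_le h1 ?_ (Filter.Eventually.of_forall fun p => ?_)
  · refine AEStronglyMeasurable.mul ?_ h1.aestronglyMeasurable
    exact Continuous.aestronglyMeasurable (by fun_prop)
  · unfold twistedTranslateFun
    rw [norm_mul, norm_exp_pi_mul_I, one_mul]
    rfl

/-- The twisted translation `T^t_{(k,l)}` on `L²(ℝ²ⁿ)`. -/
def twistedTranslate {n : ℕ} (k l : Fin n → ℤ) (φ : L2R2n n) : L2R2n n :=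
  (memLp_twistedTranslateFun k l φ).toLp _

/-- The system `E^t(φ) = {T^t_{(k,l)} φ : k, l ∈ ℤⁿ}`. -/
def twistedSystem {n : ℕ} (φ : L2R2n n) : (Fin n → ℤ) × (Fin n → ℤ) → L2R2n n :=
  fun q => twistedTranslate q.1 q.2 φ

/-- The principal twisted shift-invariant space `V^t(φ)`, the closed span of `E^t(φ)`. -/
def principalSpace {n : ℕ} (φ : L2R2n n) : Submodule ℂ (L2R2n n) :=
  (Submodule.span ℂ (Set.range (twistedSystem φ))).topologicalClosure

/-! ### The kernel of the Weyl transform -/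

/-- The kernel `K_g(ξ, η) = ∫ g(x, η - ξ) e^{πi x·(ξ+η)} dx` of the Weyl transform of an
integrable function `g`. -/
def weylKernelFun {n : ℕ} (g : Rn n × Rn n → ℂ) (p : Rn n × Rn n) : ℂ :=
  ∫ x : Rn n, g (x, p.2 - p.1) *
    Complex.exp (Real.pi * Complex.I * ((inner ℝ x (p.1 + p.2) : ℝ) : ℂ))

/-- Plancherel's theorem for the inverse Fourier integral on `L¹ ∩ L²`. -/
theorem fourierInv_integral_ae_eq {n : ℕ} {h : Rn n → ℂ} (h1 : Integrable h)
    (h2 : MemLp h 2 volume) : 𝓕⁻ h =ᵐ[volume] (𝓕⁻ (h2.toLp h) : Lp ℂ 2 (volume : Measure (Rn n))) := by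
  have hcont : Continuous (𝓕⁻ h) := by
    rw [Real.fourierInv_eq_fourier_comp_neg]
    exact VectorFourier.fourierIntegral_continuous Real.continuous_fourierChar
      (by exact continuous_inner) h1.comp_neg
  refine ae_eq_of_integral_contDiff_smul_eq hcont.locallyIntegrable
    ((Lp.memLp _).locallyIntegrable (by norm_num)) fun g hg hgc => ?_
  have hg₁ : HasCompactSupport (Complex.ofRealCLM ∘ g) := hgc.comp_left rfl
  have hg₂ : ContDiff ℝ (⊤ : ℕ∞) (Complex.ofRealCLM ∘ g) := by fun_prop
  have key := congrArg (fun T => T (hg₁.toSchwartzMap hg₂))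
    (Lp.fourierInv_toTemperedDistribution_eq (h2.toLp h))
  simp only [TemperedDistribution.fourierInv_apply, Lp.toTemperedDistribution_apply] at key
  have e1 : ∫ x, g x • 𝓕⁻ h x = ∫ x, (𝓕⁻ (hg₁.toSchwartzMap hg₂)) x • h x := by
    have e0 := VectorFourier.integral_fourierIntegral_smul_eq_flip (μ := (volume : Measure (Rn n)))
      (ν := (volume : Measure (Rn n))) (L := -innerₗ (Rn n)) Real.continuous_fourierChar
      (by exact (continuous_inner (𝕜 := ℝ) (E := Rn n)).neg)
      (hg₁.toSchwartzMap hg₂).integrable h1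
    rw [SchwartzMap.fourierInv_coe]
    have e3 : (-innerₗ (Rn n)).flip = -innerₗ (Rn n) := by
      ext x y : 2
      simp [real_inner_comm]
    rw [e3] at e0
    refine Eq.trans ?_ e0.symm
    refine integral_congr_ae (Filter.Eventually.of_forall fun x => ?_)
    exact Complex.real_smul
  have e2 : ∫ x, (𝓕⁻ (hg₁.toSchwartzMap hg₂)) x • (h2.toLp h) x
      = ∫ x, (𝓕⁻ (hg₁.toSchwartzMap hg₂)) x • h x := by
    refine integral_congr_ae ?_
    filter_upwards [h2.coeFn_toLp] with x hx
    rw [hx]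
  rw [e1, ← e2, key]
  refine integral_congr_ae (Filter.Eventually.of_forall fun x => ?_)
  simp

theorem lintegral_fourierInv_sq {n : ℕ} {h : Rn n → ℂ} (h1 : Integrable h)
    (h2 : MemLp h 2 volume) : ∫⁻ v, ‖𝓕⁻ h v‖ₑ ^ 2 = ∫⁻ x, ‖h x‖ₑ ^ 2 := by
  have key : eLpNorm (𝓕⁻ h) 2 volume = eLpNorm h 2 volume := by
    rw [eLpNorm_congr_ae (fourierInv_integral_ae_eq h1 h2), ← Lp.enorm_def,
      ← eLpNorm_congr_ae h2.coeFn_toLp, ← Lp.enorm_def, enorm_eq_iff_norm_eq]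
    exact (Lp.fourierTransformₗᵢ (Rn n) ℂ).symm.norm_map _
  have e : ∀ f : Rn n → ℂ, ∫⁻ v, ‖f v‖ₑ ^ 2 = eLpNorm f 2 volume ^ 2 := fun f => by
    have := eLpNorm_nnreal_pow_eq_lintegral (f := f) (μ := (volume : Measure (Rn n))) (p := 2)
      (by norm_num)
    simpa using this.symm
  rw [e, e, key]

theorem stronglyMeasurable_weylKernelFun {n : ℕ} {g : Rn n × Rn n → ℂ} (hg : StronglyMeasurable g) :
    StronglyMeasurable (weylKernelFun g) := by
  refine StronglyMeasurable.integral_prod_right' (f := fun q : (Rn n × Rn n) × Rn n =>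
    g (q.2, q.1.2 - q.1.1) *
      Complex.exp (Real.pi * Complex.I * ((inner ℝ q.2 (q.1.1 + q.1.2) : ℝ) : ℂ))) ?_
  refine StronglyMeasurable.mul (hg.comp_measurable (by fun_prop)) ?_
  exact Continuous.stronglyMeasurable (by fun_prop)

theorem weylKernelFun_shear {n : ℕ} (g : Rn n × Rn n → ℂ) (ξ y : Rn n) :
    weylKernelFun g (ξ, ξ + y) = 𝓕⁻ (fun x => g (x, y)) (ξ + (1 / 2 : ℝ) • y) := by
  rw [Real.fourierInv_eq', weylKernelFun]
  refine integral_congr_ae (Filter.Eventually.of_forall fun x => ?_)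
  simp only [smul_eq_mul, add_sub_cancel_left]
  rw [mul_comm]
  congr 2
  simp only [inner_add_right, inner_smul_right]
  push_cast
  ring

theorem lintegral_weylKernelFun_sq {n : ℕ} {g : Rn n × Rn n → ℂ} (hg : StronglyMeasurable g)
    (h1 : Integrable g) (h2 : MemLp g 2 volume) :
    ∫⁻ p, ‖weylKernelFun g p‖ₑ ^ 2 = ∫⁻ p, ‖g p‖ₑ ^ 2 := by
  have hK : Measurable fun p => ‖weylKernelFun g p‖ₑ ^ 2 :=
    (stronglyMeasurable_weylKernelFun hg).measurable.enorm.pow_const 2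
  have hsh := measurePreserving_prod_add (volume : Measure (Rn n)) (volume : Measure (Rn n))
  have hsq : Integrable (fun p => ‖g p‖ ^ 2) := h2.integrable_norm_pow (by norm_num)
  rw [Measure.volume_eq_prod] at h1 hsq ⊢
  rw [← hsh.lintegral_comp hK, lintegral_prod_symm' _ (by exact hK.comp hsh.measurable),
    lintegral_prod_symm' _ (hg.measurable.enorm.pow_const 2)]
  refine lintegral_congr_ae ?_
  filter_upwards [h1.prod_left_ae, hsq.prod_left_ae] with y hy1 hy2
  simp only [weylKernelFun_shear]
  have hy3 : MemLp (fun x => g (x, y)) 2 volume :=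
    (memLp_two_iff_integrable_sq_norm hy1.aestronglyMeasurable).2 hy2
  rw [lintegral_add_right_eq_self (fun v => ‖𝓕⁻ (fun x => g (x, y)) v‖ₑ ^ 2),
    lintegral_fourierInv_sq hy1 hy3]

theorem weylKernelFun_ae_slice {n : ℕ} {P : Rn n → Prop} (h : ∀ᵐ y, P y) :
    ∀ᵐ p : Rn n × Rn n, P (p.2 - p.1) :=
  ((Measure.quasiMeasurePreserving_snd).comp (measurePreserving_prod_sub
    (volume : Measure (Rn n)) (volume : Measure (Rn n))).quasiMeasurePreserving).ae h

theorem weylKernelFun_congr_ae {n : ℕ} {g g' : Rn n × Rn n → ℂ} (h : g =ᵐ[volume] g') :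
    weylKernelFun g =ᵐ[volume] weylKernelFun g' := by
  have h' : ∀ᵐ y : Rn n, ∀ᵐ x : Rn n, g (x, y) = g' (x, y) := by
    have : ∀ᵐ q : Rn n × Rn n, g q.swap = g' q.swap :=
      (Measure.measurePreserving_swap (μ := (volume : Measure (Rn n)))
        (ν := (volume : Measure (Rn n)))).quasiMeasurePreserving.ae h
    exact Measure.ae_ae_of_ae_prod this
  filter_upwards [weylKernelFun_ae_slice h'] with p hp
  refine integral_congr_ae ?_
  filter_upwards [hp] with x hx
  rw [hx]

theorem integrable_weylKernelFun_integrand {n : ℕ} {g : Rn n × Rn n → ℂ} (h : Integrable g) :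
    ∀ᵐ p : Rn n × Rn n, Integrable (fun x : Rn n => g (x, p.2 - p.1) *
      Complex.exp (Real.pi * Complex.I * ((inner ℝ x (p.1 + p.2) : ℝ) : ℂ))) := by
  rw [Measure.volume_eq_prod] at h
  filter_upwards [weylKernelFun_ae_slice h.prod_left_ae] with p hp
  refine hp.mul_bdd (c := 1) (Continuous.aestronglyMeasurable (by fun_prop)) ?_
  exact Filter.Eventually.of_forall fun x => (norm_exp_pi_mul_I _).le

/-- The subspace `L¹ ∩ L²` of `L²(ℝ²ⁿ)`. -/
def L1L2 (n : ℕ) : Submodule ℂ (L2R2n n) where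
  carrier := {g | Integrable (g : Rn n × Rn n → ℂ) volume}
  zero_mem' := (integrable_zero _ _ _).congr (Lp.coeFn_zero ..).symm
  add_mem' := fun {a b} ha hb => (ha.add hb).congr (Lp.coeFn_add a b).symm
  smul_mem' := fun c a ha => (Integrable.smul c ha).congr (Lp.coeFn_smul c a).symm

theorem eLpNorm_weylKernelFun {n : ℕ} (g : L1L2 n) :
    eLpNorm (weylKernelFun (g : L2R2n n)) 2 volume = eLpNorm (g : L2R2n n) 2 volume := by
  have e : ∀ f : Rn n × Rn n → ℂ, eLpNorm f 2 volume ^ 2 = ∫⁻ v, ‖f v‖ₑ ^ 2 := fun f => by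
    have := eLpNorm_nnreal_pow_eq_lintegral (f := f) (μ := (volume : Measure (Rn n × Rn n)))
      (p := 2) (by norm_num)
    simpa using this
  have := lintegral_weylKernelFun_sq (Lp.stronglyMeasurable (g : L2R2n n)) g.2 (Lp.memLp _)
  rw [← e, ← e] at this
  exact (ENNReal.pow_right_strictMono two_ne_zero).injective this

theorem memLp_weylKernelFun {n : ℕ} (g : L1L2 n) :
    MemLp (weylKernelFun (g : L2R2n n)) 2 volume :=
  ⟨(stronglyMeasurable_weylKernelFun (Lp.stronglyMeasurable _)).aestronglyMeasurable,
    (eLpNorm_weylKernelFun g).trans_lt (Lp.memLp (g : L2R2n n)).2⟩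

/-- The map `g ↦ K_g` on `L¹ ∩ L²`, with values in `L²(ℝ²ⁿ)`. -/
def weylKernelL1L2 (n : ℕ) : L1L2 n →ₗ[ℂ] L2R2n n where
  toFun g := (memLp_weylKernelFun g).toLp _
  map_add' a b := by
    rw [← MemLp.toLp_add, MemLp.toLp_eq_toLp_iff]
    filter_upwards [weylKernelFun_congr_ae (Lp.coeFn_add (a : L2R2n n) b),
      integrable_weylKernelFun_integrand a.2, integrable_weylKernelFun_integrand b.2]
      with p hp ha hb
    refine hp.trans ?_
    simp only [weylKernelFun, Pi.add_apply, add_mul]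
    exact integral_add ha hb
  map_smul' c a := by
    rw [RingHom.id_apply, ← MemLp.toLp_const_smul, MemLp.toLp_eq_toLp_iff]
    filter_upwards [weylKernelFun_congr_ae (Lp.coeFn_smul c (a : L2R2n n))] with p hp
    refine hp.trans ?_
    simp only [weylKernelFun, Pi.smul_apply, smul_eq_mul, mul_assoc]
    exact integral_const_mul c _

/-- The kernel `K_φ ∈ L²(ℝ²ⁿ)` of the Weyl transform of `φ ∈ L²(ℝ²ⁿ)`: the continuous extension
of `g ↦ K_g` from `L¹ ∩ L²` to `L²`. -/
def weylKernel {n : ℕ} : L2R2n n →L[ℂ] L2R2n n :=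
  (weylKernelL1L2 n).extendOfNorm (L1L2 n).subtype

theorem denseRange_L1L2 (n : ℕ) : DenseRange (L1L2 n).subtype := by
  have h := Lp.simpleFunc.dense (E := ℂ) (p := 2) (μ := (volume : Measure (Rn n × Rn n)))
    (by norm_num)
  refine h.mono ?_
  intro f hf
  refine ⟨⟨f, ?_⟩, rfl⟩
  have h1 : MemLp (Lp.simpleFunc.toSimpleFunc ⟨f, hf⟩) 2 (volume : Measure (Rn n × Rn n)) :=
    Lp.simpleFunc.memLp _
  exact ((SimpleFunc.memLp_iff_integrable two_ne_zero (by norm_num)).1 h1).congr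
    (Lp.simpleFunc.toSimpleFunc_eq_toFun ⟨f, hf⟩)

theorem norm_weylKernelL1L2 {n : ℕ} (g : L1L2 n) : ‖weylKernelL1L2 n g‖ = ‖g‖ := by
  change ‖(memLp_weylKernelFun g).toLp _‖ = ‖(g : L2R2n n)‖
  rw [Lp.norm_toLp, eLpNorm_weylKernelFun, ← Lp.norm_def]

/-- On `L¹ ∩ L²` the kernel is given by the integral formula. -/
theorem weylKernel_ae_eq {n : ℕ} (g : L2R2n n) (hg : Integrable g volume) :
    weylKernel g =ᵐ[volume] weylKernelFun g := by
  have h : weylKernel g = weylKernelL1L2 n ⟨g, hg⟩ :=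
    LinearMap.extendOfNorm_eq (e := (L1L2 n).subtype) (denseRange_L1L2 n)
      ⟨1, fun x => by rw [one_mul, norm_weylKernelL1L2]; rfl⟩ ⟨g, hg⟩
  rw [h]
  exact (memLp_weylKernelFun ⟨g, hg⟩).coeFn_toLp

/-! ### The Weyl-Zak transform -/

/-- The fundamental domain `[0,1)ⁿ` of the torus `𝕋ⁿ = ℝⁿ/ℤⁿ`. -/
def unitCube (n : ℕ) : Set (Rn n) := {x | ∀ i, x i ∈ Set.Ico (0 : ℝ) 1}

theorem isFiniteMeasure_restrict_unitCube (n : ℕ) :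
    IsFiniteMeasure ((volume : Measure (Rn n)).restrict (unitCube n)) := by
  refine isFiniteMeasure_restrict.2 (ne_of_lt (Bornology.IsBounded.measure_lt_top ?_))
  refine (isBounded_iff_forall_norm_le).2 ⟨Real.sqrt n, fun x hx => ?_⟩
  rw [EuclideanSpace.norm_eq]
  refine Real.sqrt_le_sqrt ?_
  calc ∑ i, ‖x i‖ ^ 2 ≤ ∑ _i : Fin n, (1 : ℝ) := Finset.sum_le_sum fun i _ => by
        have h := hx i
        rw [Real.norm_eq_abs, sq_abs]
        nlinarith [h.1, h.2]
    _ = n := by simp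

/-- The normalised Lebesgue measure of `𝕋ⁿ × 𝕋ⁿ`, carried by `[0,1)ⁿ × [0,1)ⁿ`. -/
def torusMeasure (n : ℕ) : Measure (Rn n × Rn n) :=
  (volume.restrict (unitCube n)).prod (volume.restrict (unitCube n))

/-- The Hilbert space `L²(𝕋ⁿ × 𝕋ⁿ × ℝⁿ)`, with points written as `((ξ, ξ'), η)`. -/
abbrev L2Zak (n : ℕ) : Type :=
  Lp ℂ 2 ((torusMeasure n).prod (volume : Measure (Rn n)))

/-- The `m`-th term `K_φ(m + ξ, η) e^{-2πi m·ξ'}` of the Weyl-Zak transform. -/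
def zakTermFun {n : ℕ} (φ : L2R2n n) (m : Fin n → ℤ) (q : (Rn n × Rn n) × Rn n) : ℂ :=
  weylKernel φ (intVec m + q.1.1, q.2) *
    Complex.exp (-2 * Real.pi * Complex.I * ((inner ℝ (intVec m) q.1.2 : ℝ) : ℂ))

theorem memLp_zakTermFun {n : ℕ} (φ : L2R2n n) (m : Fin n → ℤ) :
    MemLp (zakTermFun φ m) 2 ((torusMeasure n).prod volume) := by
  have : IsFiniteMeasure (volume.restrict (unitCube n)) := isFiniteMeasure_restrict_unitCube n
  have h0 : MemLp (fun p : Rn n × Rn n => weylKernel φ (intVec m + p.1, p.2)) 2 volume :=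
    (Lp.memLp (weylKernel φ)).comp_measurePreserving
      ((measurePreserving_add_left volume (intVec m)).prod (MeasurePreserving.id volume))
  have h1 : MemLp (fun p : Rn n × Rn n => weylKernel φ (intVec m + p.1, p.2)) 2
      ((volume.restrict (unitCube n)).prod volume) :=
    h0.mono_measure (Measure.prod_mono Measure.restrict_le_self le_rfl)
  have hmp : MeasurePreserving (fun q : (Rn n × Rn n) × Rn n => ((q.1.1, q.2), q.1.2))
      ((torusMeasure n).prod volume)
      (((volume.restrict (unitCube n)).prod volume).prod (volume.restrict (unitCube n))) :=
    ((measurePreserving_prodAssoc _ _ _).symm MeasurableEquiv.prodAssoc).comp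
      (((MeasurePreserving.id _).prod Measure.measurePreserving_swap).comp
        (measurePreserving_prodAssoc _ _ _))
  have h2 := (h1.comp_fst (volume.restrict (unitCube n))).comp_measurePreserving hmp
  refine MemLp.of_le h2 (AEStronglyMeasurable.mul h2.aestronglyMeasurable
    (Continuous.aestronglyMeasurable (by fun_prop))) (Filter.Eventually.of_forall fun q => ?_)
  unfold zakTermFun
  rw [norm_mul, show (-2 * Real.pi * Complex.I * ((inner ℝ (intVec m) q.1.2 : ℝ) : ℂ)) =
    Real.pi * Complex.I * ((-2 * inner ℝ (intVec m) q.1.2 : ℝ) : ℂ) by push_cast; ring,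
    norm_exp_pi_mul_I, mul_one]
  rfl

/-- The Weyl-Zak transform `Z_W φ(ξ, ξ', η) = ∑_{m ∈ ℤⁿ} K_φ(m + ξ, η) e^{-2πi m·ξ'}`, the series
being taken in `L²(𝕋ⁿ × 𝕋ⁿ × ℝⁿ)`. -/
def zakTransform {n : ℕ} (φ : L2R2n n) : L2Zak n :=
  ∑' m : Fin n → ℤ, (memLp_zakTermFun φ m).toLp _

/-- The bracket map `[φ, ψ](ξ, ξ') = ∫ Z_W φ(ξ, ξ', η) conj (Z_W ψ(ξ, ξ', η)) dη`. -/
def bracket {n : ℕ} (φ ψ : L2R2n n) (p : Rn n × Rn n) : ℂ :=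
  ∫ η : Rn n, zakTransform φ (p, η) * conj (zakTransform ψ (p, η))

/-- The set `Ω_φ` of the `(ξ, ξ') ∈ 𝕋ⁿ × 𝕋ⁿ` with `[φ, φ](ξ, ξ') ≠ 0`. -/
def bracketSupport {n : ℕ} (φ : L2R2n n) : Set (Rn n × Rn n) :=
  {p | p ∈ unitCube n ×ˢ unitCube n ∧ bracket φ φ p ≠ 0}

open Classical in
/-- The map `𝒥 : L²(ℝ²ⁿ) → L²(𝕋ⁿ × 𝕋ⁿ, L²(ℝⁿ))`, `𝒥 f(ξ, ξ')(η) = Z_W f(ξ, ξ', η)`. The slice of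
`Z_W f` at `(ξ, ξ')` belongs to `L²(ℝⁿ)` for almost every `(ξ, ξ')`; the value at the other points
is set to `0`. -/
def fiberMap {n : ℕ} (f : L2R2n n) (p : Rn n × Rn n) : Lp ℂ 2 (volume : Measure (Rn n)) :=
  if h : MemLp (fun η => zakTransform f (p, η)) 2 volume then h.toLp _ else 0

end TwistedShift

end

/-! A family is a Parseval frame for its closed span exactly when its Gram matrix `G` satisfies `G²
= G` (`isParsevalFrame_closure_span_iff`). The Weyl–Zak transform makes `G` explicit. It is an
isometry (`norm_zakTransform`), and it turns `T^t_{(k,l)}` into multiplication by the constant phase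
`e^{πi k·l}` times the character `e^{2πi(k·ξ + l·ξ')}` (`zakTransform_twistedTranslate`).
Integrating out `η`, the entries of `G` are, up to these phases, the Fourier coefficients `ŵ(k - j)`
of `w = [φ, φ]` (`inner_twistedTranslate`).

The phases amount to conjugation by a diagonal unitary and do not affect idempotence. What remains
is a convolution matrix, whose square corresponds to `w²`, so `G² = G` means `w² = w` almost
everywhere (`hasSum_torusCoeff_iff_sq_eq`). Thus `w` takes only the values 0 and 1, and since `w =
‖𝒥φ‖²` this is the condition on `Ω_φ`.

The analytic difficulty is that `w` is a priori only in `L¹`. Idempotence of `G` makes `ŵ` square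
summable, and then `w ∈ L²` by Riesz–Fischer and uniqueness of Fourier coefficients in `L¹`; only
after that may Parseval be applied to `w`. -/

namespace TwistedShift

/-! ### Fourier series on the torus, carried over to the cube `[0,1)ⁿ × [0,1)ⁿ`. -/

section Torus

open UnitAddTorus Filter Topology

-- Makes `volume` on the torus the Haar measure of total mass 1, for which the characters are
-- orthonormal.
noncomputable local instance : MeasureSpace UnitAddCircle := ⟨AddCircle.haarAddCircle⟩

noncomputable local instance : Measure.IsAddHaarMeasure (volume : Measure UnitAddCircle) :=
  inferInstanceAs (Measure.IsAddHaarMeasure AddCircle.haarAddCircle)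

noncomputable local instance : IsProbabilityMeasure (volume : Measure UnitAddCircle) :=
  inferInstanceAs (IsProbabilityMeasure AddCircle.haarAddCircle)

/-- Integration against `f ∈ L¹` is a continuous functional on `C(𝕋)` that kills every character,
and the span of the characters is dense in the sup norm. -/
theorem integral_continuousMap_mul_eq_zero {d : Type*} [Fintype d] {f : UnitAddTorus d → ℂ}
    (hf : Integrable f) (h0 : ∀ k, mFourierCoeff f k = 0) (g : C(UnitAddTorus d, ℂ)) :
    ∫ t, g t * f t = 0 := by
  have hint : ∀ g : C(UnitAddTorus d, ℂ), Integrable fun t => g t * f t := fun g =>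
    hf.bdd_mul (c := ‖g‖) g.continuous.aestronglyMeasurable
      (Eventually.of_forall g.norm_coe_le_norm)
  let T : C(UnitAddTorus d, ℂ) →L[ℂ] ℂ := LinearMap.mkContinuous
    { toFun := fun g => ∫ t, g t * f t
      map_add' := fun a b => by
        rw [← integral_add (hint a) (hint b)]
        exact integral_congr_ae (Eventually.of_forall fun t => by simp [add_mul])
      map_smul' := fun c a => by
        rw [RingHom.id_apply, smul_eq_mul, ← integral_const_mul]
        exact integral_congr_ae (Eventually.of_forall fun t => by simp [mul_assoc]) }
    (∫ t, ‖f t‖) fun g => by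
      refine (norm_integral_le_integral_norm _).trans ?_
      rw [mul_comm, ← integral_const_mul]
      refine integral_mono (hint g).norm (hf.norm.const_mul _) fun t => ?_
      simp only [norm_mul]
      gcongr
      exact g.norm_coe_le_norm t
  have hle : (Submodule.span ℂ (Set.range (mFourier (d := d)))).topologicalClosure ≤
      LinearMap.ker (T : C(UnitAddTorus d, ℂ) →ₗ[ℂ] ℂ) := by
    refine Submodule.topologicalClosure_minimal _ (Submodule.span_le.2 ?_) T.isClosed_ker
    rintro _ ⟨k, rfl⟩
    have := h0 (-k)
    rw [mFourierCoeff, neg_neg] at this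
    exact this
  rw [span_mFourier_closure_eq_top] at hle
  exact hle (x := g) trivial

/-- It suffices that `f` integrates to zero over closed sets. Their indicators are pointwise limits
of continuous functions bounded by 1, so the previous lemma and dominated convergence apply. -/
theorem ae_eq_zero_of_mFourierCoeff_eq_zero {d : Type*} [Fintype d] {f : UnitAddTorus d → ℂ}
    (hf : Integrable f) (h0 : ∀ k, mFourierCoeff f k = 0) : f =ᵐ[volume] 0 := by
  refine ae_eq_zero_of_forall_setIntegral_isClosed_eq_zero hf fun s hs => ?_
  have hpos : ∀ m : ℕ, (0 : ℝ) < 1 / ((m : ℝ) + 1) := fun m => by positivity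
  have h1 : Tendsto (fun m => ∫ t, (((thickenedIndicator (hpos m) s t : NNReal) : ℝ) : ℂ) * f t)
      atTop (𝓝 (∫ t, s.indicator f t)) := by
    refine tendsto_integral_of_dominated_convergence (fun t => ‖f t‖) (fun m => ?_) hf.norm
      (fun m => Eventually.of_forall fun t => ?_) (Eventually.of_forall fun t => ?_)
    · exact (Continuous.aestronglyMeasurable (by fun_prop)).mul hf.aestronglyMeasurable
    · have := thickenedIndicator_le_one (hpos m) s t
      rw [norm_mul]
      refine mul_le_of_le_one_left (norm_nonneg _) ?_
      simpa using this
    · have := thickenedIndicator_tendsto_indicator_closure hpos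
        tendsto_one_div_add_atTop_nhds_zero_nat s
      rw [tendsto_pi_nhds] at this
      have h2 := this t
      rw [hs.closure_eq] at h2
      have h3 : Tendsto (fun m => (((thickenedIndicator (hpos m) s t : NNReal) : ℝ) : ℂ) * f t)
          atTop (𝓝 ((((s.indicator (fun _ => (1 : NNReal)) t : NNReal) : ℝ) : ℂ) * f t)) :=
        (((Complex.continuous_ofReal.comp NNReal.continuous_coe).tendsto _).comp h2).mul_const _
      convert h3 using 2
      by_cases ht : t ∈ s <;> simp [ht]
  rw [integral_indicator hs.measurableSet] at h1
  refine tendsto_nhds_unique h1 (Tendsto.congr (fun m => ?_) tendsto_const_nhds)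
  exact (integral_continuousMap_mul_eq_zero hf h0
    ⟨fun t => (((thickenedIndicator (hpos m) s t : NNReal) : ℝ) : ℂ), by fun_prop⟩).symm

/-- Riesz–Fischer produces an `L²` function with the coefficients of `f`; uniqueness in `L¹`
identifies it with `f`. -/
theorem memLp_two_of_summable_mFourierCoeff {d : Type*} [Fintype d] {f : UnitAddTorus d → ℂ}
    (hf : Integrable f) (hs : Summable fun k => ‖mFourierCoeff f k‖ ^ 2) :
    MemLp f 2 volume := by
  have hm : Memℓp (fun k => mFourierCoeff f k) 2 := by
    refine memℓp_gen ?_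
    simpa using hs
  let h : Lp ℂ 2 (volume : Measure (UnitAddTorus d)) := mFourierBasis.repr.symm ⟨_, hm⟩
  have hh : ∀ k, mFourierCoeff h k = mFourierCoeff f k := fun k => by
    rw [← mFourierBasis_repr, LinearIsometryEquiv.apply_symm_apply]
  have hi : Integrable h := (Lp.memLp h).integrable (by norm_num)
  have hz : (fun t => f t - h t) =ᵐ[volume] 0 := by
    refine ae_eq_zero_of_mFourierCoeff_eq_zero (hf.sub hi) fun k => ?_
    have hb : ∀ g : UnitAddTorus d → ℂ, Integrable g →
        Integrable fun t => mFourier (-k) t • g t := fun g hg =>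
      hg.bdd_mul (c := ‖mFourier (-k)‖) (mFourier (-k)).continuous.aestronglyMeasurable
        (Eventually.of_forall (mFourier (-k)).norm_coe_le_norm)
    have h2 := hh k
    simp only [mFourierCoeff, smul_sub] at h2 ⊢
    rw [integral_sub (hb f hf) (hb h hi), h2, sub_self]
  refine (Lp.memLp h).ae_eq ?_
  filter_upwards [hz] with t ht
  exact (sub_eq_zero.1 ht).symm

theorem measurableSet_unitCube (n : ℕ) : MeasurableSet (unitCube n) := by
  simp only [unitCube, Set.mem_Ico, Set.ofPred_forall]
  exact MeasurableSet.iInter fun i =>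
    measurableSet_Ico.preimage (by fun_prop : Measurable fun x : Rn n => x i)

/-- The section `t ↦ ξ` of the covering map onto the torus, with values in `(0,1]ⁿ`. -/
noncomputable def torusSection (n : ℕ) (t : UnitAddTorus (Fin n)) : Rn n :=
  WithLp.toLp 2 (measurableEquivPiIoc (fun _ => (0 : ℝ)) t).1

theorem measurePreserving_torusSection (n : ℕ) :
    MeasurePreserving (torusSection n) volume (volume.restrict (unitCube n)) := by
  have hms : MeasurableSet {x : Fin n → ℝ | ∀ i, x i ∈ Set.Ioc (0 : ℝ) (0 + 1)} :=
    MeasurableSet.univ_pi' fun i => measurableSet_Ioc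
  have h1 : MeasurePreserving
      (Subtype.val : {x : Fin n → ℝ // ∀ i, x i ∈ Set.Ioc (0 : ℝ) (0 + 1)} → _)
      (Measure.comap Subtype.val volume)
      (volume.restrict {x : Fin n → ℝ | ∀ i, x i ∈ Set.Ioc (0 : ℝ) (0 + 1)}) :=
    ⟨measurable_subtype_coe, map_comap_subtype_coe hms volume⟩
  -- The section lands in `(0,1]ⁿ` while the domain is `[0,1)ⁿ`; both agree with the closed cube up
  -- to a null set.
  have h2 : {x : Fin n → ℝ | ∀ i, x i ∈ Set.Ioc (0 : ℝ) (0 + 1)} =ᵐ[volume]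
      ((WithLp.toLp 2 : (Fin n → ℝ) → Rn n) ⁻¹' unitCube n : Set (Fin n → ℝ)) := by
    have h3 : {x : Fin n → ℝ | ∀ i, x i ∈ Set.Ioc (0 : ℝ) (0 + 1)} =
        Set.univ.pi fun _ => Set.Ioc 0 1 := by ext; simp
    have h4 : ((WithLp.toLp 2 : (Fin n → ℝ) → Rn n) ⁻¹' unitCube n : Set (Fin n → ℝ)) =
        Set.univ.pi fun _ => Set.Ico 0 1 := by ext; simp [unitCube]
    rw [h3, h4, volume_pi]
    exact (Measure.univ_pi_Ioc_ae_eq_Icc).trans (Measure.univ_pi_Ico_ae_eq_Icc).symm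
  rw [Measure.restrict_congr_set h2] at h1
  exact ((PiLp.volume_preserving_toLp (Fin n)).restrict_preimage (measurableSet_unitCube n)).comp
    (h1.comp (measurePreserving_equivPiIoc _))

/-- The character `(ξ, ξ') ↦ e^{2πi(k·ξ + l·ξ')}` of `𝕋ⁿ × 𝕋ⁿ`. -/
noncomputable def torusChar {n : ℕ} (k : (Fin n → ℤ) × (Fin n → ℤ)) (p : Rn n × Rn n) : ℂ :=
  Complex.exp (2 * Real.pi * Complex.I *
    ((inner ℝ (intVec k.1) p.1 + inner ℝ (intVec k.2) p.2 : ℝ) : ℂ))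

theorem inner_intVec {n : ℕ} (k : Fin n → ℤ) (x : Rn n) :
    inner ℝ (intVec k) x = ∑ i, (k i : ℝ) * x i := by
  simp [PiLp.inner_apply, intVec, mul_comm]

theorem mFourier_eq_exp {n : ℕ} (k : Fin n → ℤ) (t : UnitAddTorus (Fin n)) :
    mFourier k t = Complex.exp (2 * Real.pi * Complex.I *
      ((inner ℝ (intVec k) (torusSection n t) : ℝ) : ℂ)) := by
  have h : ∀ i, t i = ((torusSection n t i : ℝ) : UnitAddCircle) := fun i =>
    (congrFun ((measurableEquivPiIoc (fun _ : Fin n => (0 : ℝ))).symm_apply_apply t) i).symm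
  simp only [mFourier, ContinuousMap.coe_mk]
  simp_rw [inner_intVec, Complex.ofReal_sum, Finset.mul_sum, Complex.exp_sum]
  refine Finset.prod_congr rfl fun i _ => ?_
  rw [h i, fourier_coe_apply]
  congr 1
  push_cast
  ring

/-- The section of the covering map onto `𝕋ⁿ × 𝕋ⁿ`, with values in `(0,1]ⁿ × (0,1]ⁿ`. -/
noncomputable def torusSection₂ (n : ℕ) (t : UnitAddTorus (Fin n ⊕ Fin n)) : Rn n × Rn n :=
  (torusSection n fun i => t (Sum.inl i), torusSection n fun i => t (Sum.inr i))

theorem measurePreserving_torusSection₂ (n : ℕ) :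
    MeasurePreserving (torusSection₂ n) volume (torusMeasure n) := by
  have : IsFiniteMeasure (volume.restrict (unitCube n)) := isFiniteMeasure_restrict_unitCube n
  exact ((measurePreserving_torusSection n).prod (measurePreserving_torusSection n)).comp
    (volume_measurePreserving_sumPiEquivProdPi fun _ : Fin n ⊕ Fin n => UnitAddCircle)

theorem isProbabilityMeasure_restrict_unitCube (n : ℕ) :
    IsProbabilityMeasure ((volume : Measure (Rn n)).restrict (unitCube n)) := by
  rw [← (measurePreserving_torusSection n).map_eq]
  exact Measure.isProbabilityMeasure_map (measurePreserving_torusSection n).aemeasurable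

theorem isProbabilityMeasure_torusMeasure (n : ℕ) : IsProbabilityMeasure (torusMeasure n) := by
  have := isProbabilityMeasure_restrict_unitCube n
  unfold torusMeasure
  infer_instance

theorem torusChar_torusSection₂ {n : ℕ} (k : (Fin n → ℤ) × (Fin n → ℤ))
    (t : UnitAddTorus (Fin n ⊕ Fin n)) :
    torusChar k (torusSection₂ n t) = mFourier (Sum.elim k.1 k.2) t := by
  have h : mFourier (Sum.elim k.1 k.2) t = mFourier k.1 (fun i => t (Sum.inl i)) *
      mFourier k.2 (fun i => t (Sum.inr i)) := by
    simp [mFourier]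
  rw [h, mFourier_eq_exp, mFourier_eq_exp, ← Complex.exp_add, torusChar, torusSection₂]
  congr 1
  push_cast
  ring

theorem torusChar_neg {n : ℕ} (k : (Fin n → ℤ) × (Fin n → ℤ)) (p : Rn n × Rn n) :
    torusChar (-k) p = conj (torusChar k p) := by
  rw [torusChar, torusChar, ← Complex.exp_conj]
  simp [inner_intVec, map_ofNat]
  ring_nf

theorem torusChar_add {n : ℕ} (k l : (Fin n → ℤ) × (Fin n → ℤ)) (p : Rn n × Rn n) :
    torusChar (k + l) p = torusChar k p * torusChar l p := by
  rw [torusChar, torusChar, torusChar, ← Complex.exp_add]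
  simp [inner_intVec, add_mul, Finset.sum_add_distrib]
  ring_nf

theorem torusChar_zero {n : ℕ} (p : Rn n × Rn n) : torusChar (0 : (Fin n → ℤ) × (Fin n → ℤ)) p = 1 := by
  simp [torusChar, inner_intVec]

theorem continuous_torusChar {n : ℕ} (k : (Fin n → ℤ) × (Fin n → ℤ)) :
    Continuous (torusChar k) := by
  unfold torusChar
  fun_prop

theorem norm_torusChar {n : ℕ} (k : (Fin n → ℤ) × (Fin n → ℤ)) (p : Rn n × Rn n) :
    ‖torusChar k p‖ = 1 := by
  have := norm_exp_pi_mul_I (2 * (inner ℝ (intVec k.1) p.1 + inner ℝ (intVec k.2) p.2))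
  rw [← this, torusChar]
  congr 2
  push_cast
  ring

/-- The Fourier coefficients of a function on `𝕋ⁿ × 𝕋ⁿ`. -/
noncomputable def torusCoeff {n : ℕ} (f : Rn n × Rn n → ℂ) (k : (Fin n → ℤ) × (Fin n → ℤ)) : ℂ :=
  ∫ p, conj (torusChar k p) * f p ∂torusMeasure n

/-- Index equivalence between pairs of integer vectors and integer vectors of double length. -/
def pairIndexEquiv (n : ℕ) : (Fin n → ℤ) × (Fin n → ℤ) ≃ (Fin n ⊕ Fin n → ℤ) :=
  (Equiv.sumArrowEquivProdArrow (Fin n) (Fin n) ℤ).symm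

theorem torusCoeff_eq_mFourierCoeff {n : ℕ} {f : Rn n × Rn n → ℂ}
    (hf : AEStronglyMeasurable f (torusMeasure n)) (k : (Fin n → ℤ) × (Fin n → ℤ)) :
    torusCoeff f k = mFourierCoeff (f ∘ torusSection₂ n) (pairIndexEquiv n k) := by
  change _ = mFourierCoeff _ (Sum.elim k.1 k.2)
  have hm : AEStronglyMeasurable (fun p => conj (torusChar k p) * f p) (torusMeasure n) :=
    (Complex.continuous_conj.comp (continuous_torusChar k)).aestronglyMeasurable.mul hf
  rw [torusCoeff, ← (measurePreserving_torusSection₂ n).map_eq] at *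
  rw [integral_map (measurePreserving_torusSection₂ n).aemeasurable hm, mFourierCoeff]
  refine integral_congr_ae (Eventually.of_forall fun t => ?_)
  simp only [torusChar_torusSection₂, mFourier_neg, smul_eq_mul, Function.comp_apply]

theorem hasSum_torusCoeff {n : ℕ} {f g : Rn n × Rn n → ℂ} (hf : MemLp f 2 (torusMeasure n))
    (hg : MemLp g 2 (torusMeasure n)) :
    HasSum (fun k => conj (torusCoeff f k) * torusCoeff g k)
      (∫ p, conj (f p) * g p ∂torusMeasure n) := by
  have hf' := hf.comp_measurePreserving (measurePreserving_torusSection₂ n)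
  have hg' := hg.comp_measurePreserving (measurePreserving_torusSection₂ n)
  have h := hasSum_prod_mFourierCoeff (hf'.toLp _) (hg'.toLp _)
  have hc : ∀ {u : UnitAddTorus (Fin n ⊕ Fin n) → ℂ} (hu : MemLp u 2 volume) k,
      mFourierCoeff (hu.toLp u) k = mFourierCoeff u k := fun hu k => by
    refine integral_congr_ae ?_
    filter_upwards [hu.coeFn_toLp] with t ht
    rw [ht]
  rw [← (pairIndexEquiv n).hasSum_iff] at h
  convert h using 1
  · ext k
    rw [Function.comp_apply, hc, hc, torusCoeff_eq_mFourierCoeff hf.1,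
      torusCoeff_eq_mFourierCoeff hg.1]
  · have hm : AEStronglyMeasurable (fun p => conj (f p) * g p) (torusMeasure n) :=
      (Complex.continuous_conj.comp_aestronglyMeasurable hf.1).mul hg.1
    rw [← (measurePreserving_torusSection₂ n).map_eq] at hm ⊢
    rw [integral_map (measurePreserving_torusSection₂ n).aemeasurable hm]
    refine integral_congr_ae ?_
    filter_upwards [hf'.coeFn_toLp, hg'.coeFn_toLp] with t h1 h2
    rw [h1, h2]
    rfl

theorem ae_eq_zero_of_torusCoeff_eq_zero {n : ℕ} {f : Rn n × Rn n → ℂ}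
    (hf : Integrable f (torusMeasure n)) (h0 : ∀ k, torusCoeff f k = 0) :
    f =ᵐ[torusMeasure n] 0 := by
  have h1 : f ∘ torusSection₂ n =ᵐ[volume] 0 := by
    refine ae_eq_zero_of_mFourierCoeff_eq_zero
      ((measurePreserving_torusSection₂ n).integrable_comp_of_integrable hf) fun k => ?_
    obtain ⟨k, rfl⟩ := (pairIndexEquiv n).surjective k
    rw [← torusCoeff_eq_mFourierCoeff hf.1, h0]
  -- Vanishing is brought back from the torus through the `L¹` seminorm, which composition with a
  -- measure preserving map does not change.
  have h2 := eLpNorm_comp_measurePreserving (p := 1) hf.1 (measurePreserving_torusSection₂ n)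
  rw [eLpNorm_congr_ae h1, eLpNorm_zero] at h2
  exact (eLpNorm_eq_zero_iff hf.1 one_ne_zero).1 h2.symm

theorem memLp_two_of_summable_torusCoeff {n : ℕ} {f : Rn n × Rn n → ℂ}
    (hf : Integrable f (torusMeasure n)) (hs : Summable fun k => ‖torusCoeff f k‖ ^ 2) :
    MemLp f 2 (torusMeasure n) := by
  refine ⟨hf.1, ?_⟩
  rw [← eLpNorm_comp_measurePreserving hf.1 (measurePreserving_torusSection₂ n)]
  refine (memLp_two_of_summable_mFourierCoeff
    ((measurePreserving_torusSection₂ n).integrable_comp_of_integrable hf) ?_).2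
  rw [← (pairIndexEquiv n).summable_iff]
  refine hs.congr fun k => ?_
  rw [Function.comp_apply, torusCoeff_eq_mFourierCoeff hf.1]

theorem integral_unitCube_exp_eq_zero {n : ℕ} {k : Fin n → ℤ} (hk : k ≠ 0) :
    ∫ x in unitCube n, Complex.exp (2 * Real.pi * Complex.I *
      ((inner ℝ (intVec k) x : ℝ) : ℂ)) = 0 := by
  rw [← (measurePreserving_torusSection n).map_eq,
    integral_map (measurePreserving_torusSection n).aemeasurable
      (Continuous.aestronglyMeasurable (by fun_prop))]
  simp_rw [← mFourier_eq_exp]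
  have h := (orthonormal_mFourier (d := Fin n)).2 hk.symm
  simp only [ContinuousMap.inner_toLp, mFourier_zero] at h
  simpa using h

end Torus
-- Parseval frames and idempotent Gram matrices.
section Frames

open Filter Topology

variable {ι H : Type*} [NormedAddCommGroup H] [InnerProductSpace ℂ H]

/-- Polarization, applied to `⟨f, g⟩` and to each term of the series with the same four combinations
`f ± g`, `f ± ig`. -/
theorem hasSum_inner_mul_inner_of_hasSum_norm_sq {V : Submodule ℂ H} {x : ι → H}
    (h : ∀ g ∈ V, HasSum (fun i => ‖inner ℂ (x i) g‖ ^ 2) (‖g‖ ^ 2)) {f g : H} (hf : f ∈ V)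
    (hg : g ∈ V) : HasSum (fun i => inner ℂ f (x i) * inner ℂ (x i) g) (inner ℂ f g) := by
  have hc : ∀ u ∈ V, HasSum (fun i => ((‖inner ℂ (x i) u‖ : ℂ)) ^ 2) ((‖u‖ : ℂ) ^ 2) := fun u hu => by
    have := (Complex.hasSum_ofReal (f := fun i => ‖inner ℂ (x i) u‖ ^ 2)).2 (h u hu)
    simpa using this
  have h1 := hc _ (V.add_mem hf hg)
  have h2 := hc _ (V.sub_mem hf hg)
  have h3 := hc _ (V.sub_mem hf (V.smul_mem Complex.I hg))
  have h4 := hc _ (V.add_mem hf (V.smul_mem Complex.I hg))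
  have key := ((h1.sub h2).add ((h3.sub h4).mul_right Complex.I)).div_const 4
  have e := inner_eq_sum_norm_sq_div_four (𝕜 := ℂ) f g
  simp only [RCLike.I_to_complex, Complex.coe_algebraMap] at e
  rw [e]
  refine key.congr_fun fun i => ?_
  have e' := inner_eq_sum_norm_sq_div_four (𝕜 := ℂ) (inner ℂ (x i) f : ℂ) (inner ℂ (x i) g)
  simp only [RCLike.I_to_complex, Complex.coe_algebraMap, RCLike.inner_apply, inner_conj_symm,
    smul_eq_mul] at e'
  simp only [inner_add_right, inner_sub_right, inner_smul_right]
  rw [mul_comm, e']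

/-- For each finite partial sum the Bessel inequality is a closed condition on the vector. -/
theorem summable_and_tsum_le_of_mem_closure {s : Set H} {x : ι → H}
    (h : ∀ g ∈ s, HasSum (fun i => ‖inner ℂ (x i) g‖ ^ 2) (‖g‖ ^ 2)) {g : H} (hg : g ∈ closure s) :
    Summable (fun i => ‖inner ℂ (x i) g‖ ^ 2) ∧ ∑' i, ‖inner ℂ (x i) g‖ ^ 2 ≤ ‖g‖ ^ 2 := by
  have hle : ∀ F : Finset ι, ∑ i ∈ F, ‖inner ℂ (x i) g‖ ^ 2 ≤ ‖g‖ ^ 2 := fun F => by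
    have hcl : IsClosed {u : H | ∑ i ∈ F, ‖inner ℂ (x i) u‖ ^ 2 ≤ ‖u‖ ^ 2} :=
      isClosed_le (by fun_prop) (by fun_prop)
    exact closure_minimal (fun u hu => sum_le_hasSum F (fun _ _ => by positivity) (h u hu)) hcl hg
  exact ⟨summable_of_sum_le (fun _ => by positivity) hle,
    Real.tsum_le_of_sum_le (fun _ => by positivity) hle⟩

/-- Weighted form of `2|a||b| ≤ ε|a|² + ε⁻¹|b|²`. The factor of `|a|²` tends to 1 with `ε`, so no
constant is lost in the limit below. -/
theorem norm_add_sq_le_mul {a b : ℂ} {ε : ℝ} (hε : 0 < ε) :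
    ‖a + b‖ ^ 2 ≤ (1 + ε) * ‖a‖ ^ 2 + (1 + ε⁻¹) * ‖b‖ ^ 2 := by
  have h1 : ‖a + b‖ ^ 2 ≤ (‖a‖ + ‖b‖) ^ 2 := by
    gcongr
    exact norm_add_le a b
  have h2 : 0 ≤ ε⁻¹ * (ε * ‖a‖ - ‖b‖) ^ 2 := by positivity
  have h3 : ε⁻¹ * (ε * ‖a‖ - ‖b‖) ^ 2 = ε * ‖a‖ ^ 2 - 2 * ‖a‖ * ‖b‖ + ε⁻¹ * ‖b‖ ^ 2 := by
    field_simp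
    ring
  linarith [add_sq ‖a‖ ‖b‖]

/-- Bessel's inequality passes to the closure. For the reverse one, approximate `g` by `u m ∈ W`,
split `u m = g + (u m - g)`, and control the error by Bessel; first `m → ∞` with `ε` fixed, then `ε
→ 0`. -/
theorem hasSum_norm_sq_of_mem_topologicalClosure {W : Submodule ℂ H} {x : ι → H}
    (h : ∀ g ∈ W, HasSum (fun i => ‖inner ℂ (x i) g‖ ^ 2) (‖g‖ ^ 2)) {g : H}
    (hg : g ∈ W.topologicalClosure) : HasSum (fun i => ‖inner ℂ (x i) g‖ ^ 2) (‖g‖ ^ 2) := by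
  obtain ⟨hs, hle⟩ := summable_and_tsum_le_of_mem_closure (s := (W : Set H)) h hg
  refine (hs.hasSum_iff).2 (le_antisymm hle ?_)
  set Q := ∑' i, ‖inner ℂ (x i) g‖ ^ 2
  obtain ⟨u, huW, hu⟩ := mem_closure_iff_seq_limit.1 (show g ∈ closure (W : Set H) from hg)
  have hε : ∀ ε : ℝ, 0 < ε → ‖g‖ ^ 2 ≤ (1 + ε) * Q := fun ε hε => by
    have hb : ∀ m, ‖u m‖ ^ 2 ≤ (1 + ε) * Q + (1 + ε⁻¹) * ‖u m - g‖ ^ 2 := fun m => by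
      have hmem : u m - g ∈ closure (W : Set H) :=
        W.topologicalClosure.sub_mem (W.le_topologicalClosure (huW m)) hg
      obtain ⟨hs', hle'⟩ := summable_and_tsum_le_of_mem_closure (s := (W : Set H)) h hmem
      rw [← (h _ (huW m)).tsum_eq]
      have h1 : ∑' i, ‖inner ℂ (x i) (u m)‖ ^ 2 ≤
          ∑' i, ((1 + ε) * ‖inner ℂ (x i) g‖ ^ 2 + (1 + ε⁻¹) * ‖inner ℂ (x i) (u m - g)‖ ^ 2) := by
        refine (h _ (huW m)).summable.tsum_le_tsum (fun i => ?_)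
          ((hs.mul_left _).add (hs'.mul_left _))
        rw [inner_sub_right]
        have := norm_add_sq_le_mul (a := inner ℂ (x i) g) (b := inner ℂ (x i) (u m) - inner ℂ (x i) g) hε
        rwa [add_sub_cancel] at this
      rw [(hs.mul_left _).tsum_add (hs'.mul_left _), tsum_mul_left, tsum_mul_left] at h1
      refine h1.trans ?_
      gcongr
    have hl : Tendsto (fun m => (1 + ε) * Q + (1 + ε⁻¹) * ‖u m - g‖ ^ 2) atTop
        (𝓝 ((1 + ε) * Q + (1 + ε⁻¹) * ‖g - g‖ ^ 2)) :=
      (((hu.sub_const g).norm.pow 2).const_mul _).const_add _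
    rw [sub_self, norm_zero, zero_pow two_ne_zero, mul_zero, add_zero] at hl
    exact le_of_tendsto_of_tendsto' (hu.norm.pow 2) hl hb
  have hl : Tendsto (fun ε : ℝ => (1 + ε) * Q) (𝓝[>] 0) (𝓝 ((1 + 0) * Q)) :=
    ((continuous_const.add continuous_id).mul continuous_const).continuousWithinAt
  rw [add_zero, one_mul] at hl
  exact ge_of_tendsto hl (eventually_mem_nhdsWithin.mono fun ε h => hε ε h)

theorem isParsevalFrame_iff_hasSum {V : Submodule ℂ H} {x : ι → H} (hx : ∀ i, x i ∈ V) :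
    IsParsevalFrame V x ↔ ∀ g ∈ V, HasSum (fun i => ‖inner ℂ (x i) g‖ ^ 2) (‖g‖ ^ 2) := by
  refine ⟨fun h g hg => ?_, fun h => ⟨one_pos, one_pos, hx, fun g hg => ?_⟩⟩
  · obtain ⟨hs, h1, h2⟩ := h.2.2.2 g hg
    rw [one_mul] at h1 h2
    exact hs.hasSum_iff.2 (le_antisymm h2 h1)
  · have := h g hg
    rw [this.tsum_eq, one_mul]
    exact ⟨this.summable, le_rfl, le_rfl⟩

/-- A family is a Parseval frame for its closed span if and only if its Gram matrix is
idempotent. -/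
theorem isParsevalFrame_closure_span_iff (x : ι → H) :
    IsParsevalFrame (Submodule.span ℂ (Set.range x)).topologicalClosure x ↔
      ∀ i j, HasSum (fun k => inner ℂ (x i) (x k) * inner ℂ (x k) (x j)) (inner ℂ (x i) (x j)) := by
  have hx : ∀ i, x i ∈ (Submodule.span ℂ (Set.range x)).topologicalClosure := fun i =>
    Submodule.le_topologicalClosure _ (Submodule.subset_span ⟨i, rfl⟩)
  rw [isParsevalFrame_iff_hasSum hx]
  refine ⟨fun h i j => hasSum_inner_mul_inner_of_hasSum_norm_sq h (hx i) (hx j),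
    fun h g hg => hasSum_norm_sq_of_mem_topologicalClosure (fun g hg => ?_) hg⟩
  have key : HasSum (fun k => inner ℂ g (x k) * inner ℂ (x k) g) (inner ℂ g g) := by
    -- The polarized identity is sesquilinear in its two arguments, so it extends from the
    -- generators, where it is idempotence of the Gram matrix, to their span.
    refine Submodule.span_induction₂ (s := Set.range x) (t := Set.range x)
      (p := fun f g _ _ => HasSum (fun k => inner ℂ f (x k) * inner ℂ (x k) g) (inner ℂ f g))
      ?_ ?_ ?_ ?_ ?_ ?_ ?_ hg hg
    · rintro _ _ ⟨i, rfl⟩ ⟨j, rfl⟩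
      exact h i j
    · intro y _
      simp
    · intro y _
      simp
    · intro a b c _ _ _ h1 h2
      simpa only [inner_add_left, add_mul] using h1.add h2
    · intro a b c _ _ _ h1 h2
      simpa only [inner_add_right, mul_add] using h1.add h2
    · intro r a b _ _ h1
      simpa only [inner_smul_left, mul_assoc] using h1.mul_left (conj r)
    · intro r a b _ _ h1
      simpa only [inner_smul_right, mul_left_comm] using h1.mul_left r
  rw [← Complex.hasSum_ofReal]
  convert key using 1
  · ext k
    rw [← inner_conj_symm g (x k), Complex.conj_mul']
    simp
  · rw [inner_self_eq_norm_sq_to_K]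
    simp

end Frames
-- Isometries of `L²` given by a unimodular weight and a measure preserving substitution.
section WeightedComposition

variable {X Y : Type*} [MeasurableSpace X] [MeasurableSpace Y] {μ : Measure X} {ν : Measure Y}

theorem memLp_mul_comp {e : X → ℂ} {τ : X → Y} (he : AEStronglyMeasurable e μ)
    (h1 : ∀ x, ‖e x‖ = 1) (hτ : MeasurePreserving τ μ ν) (f : Lp ℂ 2 ν) :
    MemLp (fun x => e x * f (τ x)) 2 μ := by
  have h := (Lp.memLp f).comp_measurePreserving hτ
  refine MemLp.of_le h (he.mul h.1) (Filter.Eventually.of_forall fun x => ?_)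
  rw [norm_mul, h1, one_mul]
  rfl

/-- The isometry `f ↦ e · (f ∘ τ)` of `L²` spaces, for `τ` measure preserving and `|e| = 1`. -/
noncomputable def weightedComp {e : X → ℂ} {τ : X → Y} (he : AEStronglyMeasurable e μ)
    (h1 : ∀ x, ‖e x‖ = 1) (hτ : MeasurePreserving τ μ ν) : Lp ℂ 2 ν →ₗᵢ[ℂ] Lp ℂ 2 μ where
  toFun f := (memLp_mul_comp he h1 hτ f).toLp _
  map_add' a b := by
    rw [← MemLp.toLp_add, MemLp.toLp_eq_toLp_iff]
    filter_upwards [hτ.quasiMeasurePreserving.ae (Lp.coeFn_add a b)] with x hx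
    simp only [hx, Pi.add_apply, mul_add]
  map_smul' c a := by
    rw [RingHom.id_apply, ← MemLp.toLp_const_smul, MemLp.toLp_eq_toLp_iff]
    filter_upwards [hτ.quasiMeasurePreserving.ae (Lp.coeFn_smul c a)] with x hx
    simp only [hx, Pi.smul_apply, smul_eq_mul, mul_left_comm]
  norm_map' f := by
    change ‖(memLp_mul_comp he h1 hτ f).toLp _‖ = ‖f‖
    rw [Lp.norm_toLp, Lp.norm_def, ← eLpNorm_comp_measurePreserving (Lp.memLp f).1 hτ]
    congr 1
    refine eLpNorm_congr_norm_ae (Filter.Eventually.of_forall fun x => ?_)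
    rw [norm_mul, h1, one_mul]
    rfl

theorem coeFn_weightedComp {e : X → ℂ} {τ : X → Y} (he : AEStronglyMeasurable e μ)
    (h1 : ∀ x, ‖e x‖ = 1) (hτ : MeasurePreserving τ μ ν) (f : Lp ℂ 2 ν) :
    weightedComp he h1 hτ f =ᵐ[μ] fun x => e x * f (τ x) :=
  (memLp_mul_comp he h1 hτ f).coeFn_toLp

end WeightedComposition

/-! ### The Weyl kernel under twisted translations. -/

section Covariance

variable {n : ℕ}

theorem measurePreserving_sub_intVec (k l : Fin n → ℤ) :
    MeasurePreserving (fun p : Rn n × Rn n => (p.1 - intVec k, p.2 - intVec l)) volume volume :=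
  (measurePreserving_sub_right volume (intVec k)).prod
    (measurePreserving_sub_right volume (intVec l))

theorem twistedTranslate_eq_weightedComp (k l : Fin n → ℤ) (φ : L2R2n n) :
    twistedTranslate k l φ = weightedComp
      (e := fun p : Rn n × Rn n => Complex.exp (Real.pi * Complex.I *
        ((inner ℝ p.1 (intVec l) - inner ℝ p.2 (intVec k) : ℝ) : ℂ)))
      (Continuous.aestronglyMeasurable (by fun_prop)) (fun _ => norm_exp_pi_mul_I _)
      (measurePreserving_sub_intVec k l) φ := rfl

theorem continuous_twistedTranslate (k l : Fin n → ℤ) :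
    Continuous (twistedTranslate k l : L2R2n n → L2R2n n) := by
  rw [funext (twistedTranslate_eq_weightedComp k l)]
  exact LinearIsometry.continuous _

/-- The phase `e^{πi k·l}`. -/
noncomputable def twistPhase (k l : Fin n → ℤ) : ℂ :=
  Complex.exp (Real.pi * Complex.I * ((inner ℝ (intVec k) (intVec l) : ℝ) : ℂ))

theorem norm_twistPhase (k l : Fin n → ℤ) : ‖twistPhase k l‖ = 1 := norm_exp_pi_mul_I _

/-- The unimodular factor `e^{πi k·l} e^{2πi k·ξ}` in the covariance relation of the Weyl kernel. -/
noncomputable def kernelFactor (k l : Fin n → ℤ) (p : Rn n × Rn n) : ℂ :=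
  twistPhase k l *
    Complex.exp (Real.pi * Complex.I * ((2 * inner ℝ (intVec k) p.1 : ℝ) : ℂ))

theorem norm_kernelFactor (k l : Fin n → ℤ) (p : Rn n × Rn n) : ‖kernelFactor k l p‖ = 1 := by
  rw [kernelFactor, norm_mul, norm_twistPhase, norm_exp_pi_mul_I, one_mul]

theorem continuous_kernelFactor (k l : Fin n → ℤ) : Continuous (kernelFactor k l) := by
  unfold kernelFactor
  fun_prop

/-- Substitute `x ↦ x + k` in the integral. Shifting the second variable by `l` replaces `ξ` by `ξ +
l`, the phase `e^{πi x·l}` supplies the matching change in the exponential, and the terms in `k·η`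
cancel. -/
theorem weylKernelFun_twistedTranslateFun (k l : Fin n → ℤ) (g : Rn n × Rn n → ℂ)
    (p : Rn n × Rn n) : weylKernelFun (twistedTranslateFun k l g) p =
      kernelFactor k l p * weylKernelFun g (p.1 + intVec l, p.2) := by
  unfold weylKernelFun
  rw [← integral_const_mul]
  refine Eq.trans ?_ (integral_sub_right_eq_self (fun x : Rn n => kernelFactor k l p *
    (g (x, p.2 - (p.1 + intVec l)) *
      Complex.exp (Real.pi * Complex.I * ((inner ℝ x (p.1 + intVec l + p.2) : ℝ) : ℂ))))
    (intVec k))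
  refine integral_congr_ae (Filter.Eventually.of_forall fun x => ?_)
  simp only [twistedTranslateFun, kernelFactor, twistPhase]
  rw [sub_sub p.2 p.1]
  have h : ∀ a b c d e z : ℂ, Complex.exp a * Complex.exp b = Complex.exp c * Complex.exp d * Complex.exp e →
      Complex.exp a * z * Complex.exp b = Complex.exp c * Complex.exp d * (z * Complex.exp e) :=
    fun a b c d e z h => by linear_combination z * h
  refine h _ _ _ _ _ _ ?_
  rw [← Complex.exp_add, ← Complex.exp_add, ← Complex.exp_add]
  congr 1
  simp only [inner_add_right, inner_sub_left, inner_sub_right, real_inner_comm (intVec k)]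
  push_cast
  ring

theorem measurePreserving_add_intVec_fst (l : Fin n → ℤ) :
    MeasurePreserving (fun p : Rn n × Rn n => (p.1 + intVec l, p.2)) volume volume :=
  (measurePreserving_add_right volume (intVec l)).prod (MeasurePreserving.id volume)

theorem continuous_weylKernel : Continuous (weylKernel : L2R2n n → L2R2n n) :=
  ContinuousLinearMap.continuous _

/-- Both sides are continuous in `φ`, and on the dense subspace `L¹ ∩ L²` the integral formula
applies. Writing the right side as a `weightedComp` is what gives its continuity. -/
theorem weylKernel_twistedTranslate_eq (k l : Fin n → ℤ) (φ : L2R2n n) :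
    weylKernel (twistedTranslate k l φ) =
      weightedComp (continuous_kernelFactor k l).aestronglyMeasurable (norm_kernelFactor k l)
        (measurePreserving_add_intVec_fst l) (weylKernel φ) := by
  refine (denseRange_L1L2 n).induction_on (p := fun φ => weylKernel (twistedTranslate k l φ) =
      weightedComp (continuous_kernelFactor k l).aestronglyMeasurable (norm_kernelFactor k l)
        (measurePreserving_add_intVec_fst l) (weylKernel φ)) φ
    (isClosed_eq (continuous_weylKernel.comp (continuous_twistedTranslate k l))
      ((LinearIsometry.continuous _).comp continuous_weylKernel)) fun g => ?_
  have hT : (twistedTranslate k l (g : L2R2n n)) =ᵐ[volume] twistedTranslateFun k l (g : L2R2n n) :=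
    (memLp_twistedTranslateFun k l (g : L2R2n n)).coeFn_toLp
  have hgT : Integrable (twistedTranslateFun k l (g : L2R2n n)) := by
    have h := (measurePreserving_sub_intVec k l).integrable_comp_of_integrable g.2
    refine h.bdd_mul (c := 1) (Continuous.aestronglyMeasurable (by fun_prop)) ?_
    exact Filter.Eventually.of_forall fun x => (norm_exp_pi_mul_I _).le
  refine Lp.ext ?_
  change weylKernel (twistedTranslate k l (g : L2R2n n)) =ᵐ[volume]
    weightedComp _ _ _ (weylKernel (g : L2R2n n))
  filter_upwards [weylKernel_ae_eq _ (hgT.congr hT.symm), weylKernelFun_congr_ae hT,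
    coeFn_weightedComp (continuous_kernelFactor k l).aestronglyMeasurable (norm_kernelFactor k l)
      (measurePreserving_add_intVec_fst l) (weylKernel (g : L2R2n n)),
    (measurePreserving_add_intVec_fst l).quasiMeasurePreserving.ae (weylKernel_ae_eq _ g.2)]
    with p h1 h2 h3 h4
  rw [h1, h2, h3, h4, weylKernelFun_twistedTranslateFun]

/-- Covariance of the Weyl kernel under twisted translations. -/
theorem weylKernel_twistedTranslate (k l : Fin n → ℤ) (φ : L2R2n n) :
    weylKernel (twistedTranslate k l φ) =ᵐ[volume]
      fun p => kernelFactor k l p * weylKernel φ (p.1 + intVec l, p.2) := by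
  rw [weylKernel_twistedTranslate_eq]
  exact coeFn_weightedComp _ _ _ _

theorem norm_weylKernel (φ : L2R2n n) : ‖weylKernel φ‖ = ‖φ‖ := by
  refine (denseRange_L1L2 n).induction_on (p := fun φ => ‖weylKernel φ‖ = ‖φ‖) φ
    (isClosed_eq continuous_weylKernel.norm continuous_norm) fun g => ?_
  have h : weylKernel (g : L2R2n n) = weylKernelL1L2 n g :=
    LinearMap.extendOfNorm_eq (e := (L1L2 n).subtype) (denseRange_L1L2 n)
      ⟨1, fun x => by rw [one_mul, norm_weylKernelL1L2]; rfl⟩ g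
  change ‖weylKernel (g : L2R2n n)‖ = ‖(g : L2R2n n)‖
  rw [h, norm_weylKernelL1L2]
  rfl

end Covariance
-- The Weyl–Zak transform is an isometry intertwining twisted translations with modulations.
section Zak

variable {n : ℕ}

theorem enorm_sq_Lp {X : Type*} [MeasurableSpace X] {μ : Measure X} (f : Lp ℂ 2 μ) :
    ‖f‖ₑ ^ 2 = ∫⁻ x, ‖f x‖ₑ ^ 2 ∂μ := by
  rw [Lp.enorm_def]
  simpa using eLpNorm_nnreal_pow_eq_lintegral (f := f) (μ := μ) (p := 2) (by norm_num)

/-- The `m`-th term of the Weyl-Zak transform as an element of `L²(𝕋ⁿ × 𝕋ⁿ × ℝⁿ)`. -/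
noncomputable def zakTerm (m : Fin n → ℤ) (φ : L2R2n n) : L2Zak n :=
  (memLp_zakTermFun φ m).toLp _

theorem coeFn_zakTerm (m : Fin n → ℤ) (φ : L2R2n n) :
    zakTerm m φ =ᵐ[(torusMeasure n).prod volume] zakTermFun φ m :=
  (memLp_zakTermFun φ m).coeFn_toLp

/-- Reordering of the variables `(ξ, ξ', η) ↦ (ξ, η, ξ')`. -/
theorem measurePreserving_zakReorder (n : ℕ) :
    MeasurePreserving (fun q : (Rn n × Rn n) × Rn n => ((q.1.1, q.2), q.1.2))
      ((torusMeasure n).prod volume)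
      (((volume.restrict (unitCube n)).prod volume).prod (volume.restrict (unitCube n))) := by
  have : IsFiniteMeasure (volume.restrict (unitCube n)) := isFiniteMeasure_restrict_unitCube n
  exact ((measurePreserving_prodAssoc _ _ _).symm MeasurableEquiv.prodAssoc).comp
    (((MeasurePreserving.id _).prod Measure.measurePreserving_swap).comp
      (measurePreserving_prodAssoc _ _ _))

theorem measurePreserving_intVec_add_fst (m : Fin n → ℤ) :
    MeasurePreserving (fun p : Rn n × Rn n => (intVec m + p.1, p.2)) volume volume :=
  (measurePreserving_add_left volume (intVec m)).prod (MeasurePreserving.id volume)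

/-- Pulls almost everywhere identities for the kernel back to the variables of the Zak transform.
Since `ξ` is confined to the cube, only null sets are respected, not the measure. -/
theorem quasiMeasurePreserving_zakArg (m : Fin n → ℤ) :
    Measure.QuasiMeasurePreserving
      (fun q : (Rn n × Rn n) × Rn n => (intVec m + q.1.1, q.2))
      ((torusMeasure n).prod volume) (volume : Measure (Rn n × Rn n)) := by
  have : IsFiniteMeasure (volume.restrict (unitCube n)) := isFiniteMeasure_restrict_unitCube n
  have h1 : Measure.QuasiMeasurePreserving (id : Rn n × Rn n → Rn n × Rn n)
      ((volume.restrict (unitCube n)).prod volume) volume :=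
    ⟨measurable_id, by
      rw [Measure.map_id]
      exact (Measure.prod_mono Measure.restrict_le_self le_rfl).absolutelyContinuous⟩
  exact ((measurePreserving_intVec_add_fst m).quasiMeasurePreserving.comp h1).comp
    (Measure.quasiMeasurePreserving_fst.comp (measurePreserving_zakReorder n).quasiMeasurePreserving)

theorem zakTerm_add (m : Fin n → ℤ) (φ ψ : L2R2n n) :
    zakTerm m (φ + ψ) = zakTerm m φ + zakTerm m ψ := by
  rw [zakTerm, zakTerm, zakTerm, ← MemLp.toLp_add, MemLp.toLp_eq_toLp_iff]
  have h := Lp.coeFn_add (weylKernel φ) (weylKernel ψ)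
  rw [← map_add] at h
  filter_upwards [(quasiMeasurePreserving_zakArg m).ae h] with q hq
  simp only [zakTermFun, Pi.add_apply, hq, add_mul]

theorem zakTerm_smul (m : Fin n → ℤ) (c : ℂ) (φ : L2R2n n) :
    zakTerm m (c • φ) = c • zakTerm m φ := by
  rw [zakTerm, zakTerm, ← MemLp.toLp_const_smul, MemLp.toLp_eq_toLp_iff]
  have h := Lp.coeFn_smul c (weylKernel φ)
  rw [← map_smul] at h
  filter_upwards [(quasiMeasurePreserving_zakArg m).ae h] with q hq
  simp only [zakTermFun, Pi.smul_apply, hq, smul_eq_mul, mul_assoc]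

/-- The strip `(m + [0,1)ⁿ) × ℝⁿ`. -/
def zakStrip (m : Fin n → ℤ) : Set (Rn n × Rn n) :=
  {p | p.1 - intVec m ∈ unitCube n}

theorem measurableSet_zakStrip (m : Fin n → ℤ) : MeasurableSet (zakStrip m) :=
  (measurableSet_unitCube n).preimage (by fun_prop : Measurable fun p : Rn n × Rn n => p.1 - intVec m)

theorem mem_zakStrip_iff (m : Fin n → ℤ) (p : Rn n × Rn n) :
    p ∈ zakStrip m ↔ (fun i => ⌊p.1 i⌋) = m := by
  rw [funext_iff]
  refine forall_congr' fun i => ?_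
  rw [Int.floor_eq_iff]
  simp only [intVec, PiLp.sub_apply, Set.mem_Ico, sub_nonneg, sub_lt_iff_lt_add']

/-- The phase is unimodular and `ξ'` ranges over a space of mass 1, so `ξ'` integrates out;
translation by `m` carries the cube to its strip. -/
theorem enorm_zakTerm_sq (m : Fin n → ℤ) (φ : L2R2n n) :
    ‖zakTerm m φ‖ₑ ^ 2 = ∫⁻ p in zakStrip m, ‖weylKernel φ p‖ₑ ^ 2 := by
  have := isProbabilityMeasure_restrict_unitCube n
  have hK : Measurable fun p => ‖weylKernel φ p‖ₑ ^ 2 :=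
    (Lp.stronglyMeasurable (weylKernel φ)).measurable.enorm.pow_const 2
  have hK' : Measurable fun p : Rn n × Rn n => ‖weylKernel φ (intVec m + p.1, p.2)‖ₑ ^ 2 :=
    hK.comp (by fun_prop)
  rw [enorm_sq_Lp, ← (measurePreserving_intVec_add_fst m).setLIntegral_comp_preimage
    (measurableSet_zakStrip m) hK]
  have h1 : (fun p : Rn n × Rn n => (intVec m + p.1, p.2)) ⁻¹' zakStrip m =
      unitCube n ×ˢ Set.univ := by
    ext p
    simp [zakStrip]
  have hr : (volume : Measure (Rn n × Rn n)).restrict (unitCube n ×ˢ Set.univ) =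
      (volume.restrict (unitCube n)).prod volume := by
    rw [Measure.volume_eq_prod, ← Measure.prod_restrict, Measure.restrict_univ]
  rw [h1, hr]
  have h2 : ∫⁻ q, ‖zakTerm m φ q‖ₑ ^ 2 ∂(torusMeasure n).prod volume =
      ∫⁻ q : (Rn n × Rn n) × Rn n, ‖weylKernel φ (intVec m + q.1.1, q.2)‖ₑ ^ 2
        ∂(torusMeasure n).prod volume := by
    refine lintegral_congr_ae ?_
    filter_upwards [coeFn_zakTerm m φ] with q hq
    rw [hq, zakTermFun, show (-2 * Real.pi * Complex.I * ((inner ℝ (intVec m) q.1.2 : ℝ) : ℂ)) =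
      Real.pi * Complex.I * ((-2 * inner ℝ (intVec m) q.1.2 : ℝ) : ℂ) by push_cast; ring,
      enorm_mul, ← ofReal_norm (Complex.exp _), norm_exp_pi_mul_I, ENNReal.ofReal_one,
      mul_one]
  rw [h2, (measurePreserving_zakReorder n).lintegral_comp
    (f := fun r : (Rn n × Rn n) × Rn n => ‖weylKernel φ (intVec m + r.1.1, r.1.2)‖ₑ ^ 2)
    (hK'.comp measurable_fst), lintegral_prod (fun r : (Rn n × Rn n) × Rn n =>
      ‖weylKernel φ (intVec m + r.1.1, r.1.2)‖ₑ ^ 2) (hK'.comp measurable_fst).aemeasurable]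
  simp

/-- The strips partition `ℝ²ⁿ`, and the Weyl kernel has the norm of `φ`. -/
theorem hasSum_norm_zakTerm_sq (φ : L2R2n n) :
    HasSum (fun m => ‖zakTerm m φ‖ ^ 2) (‖φ‖ ^ 2) := by
  have h : ∑' m : Fin n → ℤ, ‖zakTerm m φ‖ₑ ^ 2 = ‖φ‖ₑ ^ 2 := by
    simp_rw [enorm_zakTerm_sq]
    have hd : Pairwise (Function.onFun Disjoint (zakStrip (n := n))) := fun m m' hm =>
      Set.disjoint_left.2 fun p hp hp' =>
        hm (((mem_zakStrip_iff m p).1 hp).symm.trans ((mem_zakStrip_iff m' p).1 hp'))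
    rw [← lintegral_iUnion measurableSet_zakStrip hd]
    have hu : ⋃ m : Fin n → ℤ, zakStrip m = Set.univ :=
      Set.eq_univ_of_forall fun p => Set.mem_iUnion.2 ⟨_, (mem_zakStrip_iff _ p).2 rfl⟩
    rw [hu, setLIntegral_univ, ← enorm_sq_Lp, enorm_eq_iff_norm_eq.2 (norm_weylKernel φ)]
  have h2 := ENNReal.hasSum_toReal (f := fun m => ‖zakTerm m φ‖ₑ ^ 2) (by rw [h]; simp)
  rw [← ENNReal.tsum_toReal_eq (by simp), h] at h2
  simpa using h2

theorem inner_zakTerm_of_ne {m m' : Fin n → ℤ} (hm : m ≠ m') (φ ψ : L2R2n n) :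
    inner ℂ (zakTerm m φ) (zakTerm m' ψ) = 0 := by
  have := isProbabilityMeasure_restrict_unitCube n
  rw [L2.inner_def]
  -- The integrand splits into `A(ξ, η)` and the character `B(ξ')` of frequency `m - m' ≠ 0`, whose
  -- integral over the cube vanishes.
  let A : Rn n × Rn n → ℂ := fun p =>
    conj (weylKernel φ (intVec m + p.1, p.2)) * weylKernel ψ (intVec m' + p.1, p.2)
  let B : Rn n → ℂ := fun x => Complex.exp (2 * Real.pi * Complex.I *
      ((inner ℝ (intVec (m - m')) x : ℝ) : ℂ))
  have hA : StronglyMeasurable A := by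
    refine StronglyMeasurable.mul (Complex.continuous_conj.comp_stronglyMeasurable
      ((Lp.stronglyMeasurable (weylKernel φ)).comp_measurable (by fun_prop)))
      ((Lp.stronglyMeasurable (weylKernel ψ)).comp_measurable (by fun_prop))
  have hB : Continuous B := by fun_prop
  have h1 : ∫ q, inner ℂ (zakTerm m φ q) (zakTerm m' ψ q) ∂(torusMeasure n).prod volume =
      ∫ q : (Rn n × Rn n) × Rn n, A (q.1.1, q.2) * B q.1.2 ∂(torusMeasure n).prod volume := by
    refine integral_congr_ae ?_
    filter_upwards [coeFn_zakTerm m φ, coeFn_zakTerm m' ψ] with q h1 h2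
    rw [h1, h2, RCLike.inner_apply, zakTermFun, zakTermFun, map_mul, ← Complex.exp_conj]
    have h3 : B q.1.2 = Complex.exp (conj (-2 * Real.pi * Complex.I *
        ((inner ℝ (intVec m) q.1.2 : ℝ) : ℂ))) * Complex.exp (-2 * Real.pi * Complex.I *
        ((inner ℝ (intVec m') q.1.2 : ℝ) : ℂ)) := by
      rw [← Complex.exp_add]
      simp only [B, inner_intVec, Pi.sub_apply, map_mul, map_neg, Complex.conj_I,
        Complex.conj_ofReal, map_ofNat, Int.cast_sub, sub_mul, Finset.sum_sub_distrib]
      congr 1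
      push_cast
      ring
    rw [h3]
    ring
  have h2 := integral_map (measurePreserving_zakReorder n).aemeasurable
    (f := fun r : (Rn n × Rn n) × Rn n => A r.1 * B r.2)
    ((hA.comp_measurable measurable_fst).mul
      (hB.stronglyMeasurable.comp_measurable measurable_snd)).aestronglyMeasurable
  rw [(measurePreserving_zakReorder n).map_eq, integral_prod_mul] at h2
  rw [h1, ← h2]
  have h3 : ∫ x in unitCube n, B x = 0 := integral_unitCube_exp_eq_zero (sub_ne_zero.2 hm)
  rw [h3, mul_zero]

theorem summable_zakTerm (φ : L2R2n n) : Summable fun m : Fin n → ℤ => zakTerm m φ := by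
  have ho : OrthogonalFamily ℂ (fun m : Fin n → ℤ => (ℂ ∙ zakTerm m φ : Submodule ℂ (L2Zak n)))
      fun m => (ℂ ∙ zakTerm m φ).subtypeₗᵢ := by
    refine OrthogonalFamily.of_pairwise fun m m' hm => ?_
    refine Submodule.isOrtho_span.2 ?_
    rintro _ rfl _ rfl
    exact inner_zakTerm_of_ne hm φ φ
  exact (ho.summable_iff_norm_sq_summable fun m =>
    ⟨zakTerm m φ, Submodule.mem_span_singleton_self _⟩).2 (hasSum_norm_zakTerm_sq φ).summable

theorem hasSum_zakTerm (φ : L2R2n n) :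
    HasSum (fun m : Fin n → ℤ => zakTerm m φ) (zakTransform φ) :=
  (summable_zakTerm φ).hasSum

/-- Pythagoras for the orthogonal terms: pairing the series with one term leaves `‖zakTerm m φ‖²`,
and summing over `m` gives `‖φ‖²`. -/
theorem norm_zakTransform (φ : L2R2n n) : ‖zakTransform φ‖ = ‖φ‖ := by
  have h1 : ∀ m, inner ℂ (zakTerm m φ) (zakTransform φ) = ((‖zakTerm m φ‖ ^ 2 : ℝ) : ℂ) := fun m => by
    have h := (hasSum_zakTerm φ).mapL (innerSL ℂ (zakTerm m φ))
    refine h.unique ?_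
    have h2 := hasSum_ite_eq m ((‖zakTerm m φ‖ ^ 2 : ℝ) : ℂ)
    refine h2.congr_fun fun m' => ?_
    rw [innerSL_apply_apply]
    split_ifs with hm
    · subst hm
      rw [inner_self_eq_norm_sq_to_K]
      simp
    · exact inner_zakTerm_of_ne (Ne.symm hm) φ φ
  have h2 := (hasSum_zakTerm φ).mapL (innerSL ℂ (zakTransform φ))
  have h3 : ∀ m, innerSL ℂ (zakTransform φ) (zakTerm m φ) = ((‖zakTerm m φ‖ ^ 2 : ℝ) : ℂ) := fun m => by
    rw [innerSL_apply_apply, ← inner_conj_symm, h1, Complex.conj_ofReal]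
  simp_rw [h3] at h2
  have h4 := h2.unique ((Complex.hasSum_ofReal).2 (hasSum_norm_zakTerm_sq φ))
  rw [innerSL_apply_apply, inner_self_eq_norm_sq_to_K] at h4
  have h5 : ((‖zakTransform φ‖ ^ 2 : ℝ) : ℂ) = ((‖φ‖ ^ 2 : ℝ) : ℂ) := by
    rw [← h4]
    simp
  exact (sq_eq_sq₀ (norm_nonneg _) (norm_nonneg _)).1 (Complex.ofReal_injective h5)

/-- The Weyl-Zak transform as a linear isometry. -/
noncomputable def zakIsometry (n : ℕ) : L2R2n n →ₗᵢ[ℂ] L2Zak n where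
  toFun := zakTransform
  map_add' φ ψ := by
    refine (hasSum_zakTerm (φ + ψ)).unique ?_
    simp_rw [zakTerm_add]
    exact (hasSum_zakTerm φ).add (hasSum_zakTerm ψ)
  map_smul' c φ := by
    refine (hasSum_zakTerm (c • φ)).unique ?_
    simp_rw [zakTerm_smul]
    exact (hasSum_zakTerm φ).const_smul c
  norm_map' := norm_zakTransform

theorem inner_zakTransform (φ ψ : L2R2n n) :
    inner ℂ (zakTransform φ) (zakTransform ψ) = inner ℂ φ ψ :=
  (zakIsometry n).inner_map_map φ ψ

/-- The unimodular factor by which `Z_W` intertwines a twisted translation. -/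
noncomputable def zakFactor (k : (Fin n → ℤ) × (Fin n → ℤ)) (q : (Rn n × Rn n) × Rn n) : ℂ :=
  twistPhase k.1 k.2 * torusChar k q.1

theorem norm_zakFactor (k : (Fin n → ℤ) × (Fin n → ℤ)) (q : (Rn n × Rn n) × Rn n) :
    ‖zakFactor k q‖ = 1 := by
  rw [zakFactor, norm_mul, norm_twistPhase, norm_torusChar, one_mul]

theorem continuous_zakFactor (k : (Fin n → ℤ) × (Fin n → ℤ)) : Continuous (zakFactor k) :=
  continuous_const.mul ((continuous_torusChar k).comp continuous_fst)

theorem exp_two_pi_inner_intVec (k m : Fin n → ℤ) :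
    Complex.exp (2 * Real.pi * Complex.I * ((inner ℝ (intVec k) (intVec m) : ℝ) : ℂ)) = 1 := by
  rw [Complex.exp_eq_one_iff]
  refine ⟨∑ i, k i * m i, ?_⟩
  rw [inner_intVec]
  simp only [intVec]
  push_cast
  ring

theorem intVec_add (k l : Fin n → ℤ) : intVec (k + l) = intVec k + intVec l := by
  ext i
  simp [intVec]

/-- The shift by `l` in the kernel moves the index from `m` to `m + l`, which leaves the factor
`e^{2πi l·ξ'}`. The factor `e^{2πi k·(m + ξ)}` loses its dependence on `m` because `k·m` is an
integer, so the same multiplier serves every term. -/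
theorem zakTerm_twistedTranslate (k : (Fin n → ℤ) × (Fin n → ℤ)) (m : Fin n → ℤ) (φ : L2R2n n) :
    zakTerm m (twistedTranslate k.1 k.2 φ) =
      weightedComp (continuous_zakFactor k).aestronglyMeasurable (norm_zakFactor k)
        (MeasurePreserving.id _) (zakTerm (m + k.2) φ) := by
  refine Lp.ext ?_
  filter_upwards [coeFn_zakTerm m (twistedTranslate k.1 k.2 φ), coeFn_zakTerm (m + k.2) φ,
    coeFn_weightedComp (continuous_zakFactor k).aestronglyMeasurable (norm_zakFactor k)
      (MeasurePreserving.id _) (zakTerm (m + k.2) φ),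
    (quasiMeasurePreserving_zakArg m).ae (weylKernel_twistedTranslate k.1 k.2 φ)]
    with q h1 h2 h3 h4
  rw [h1, h3, id, h2]
  simp only [zakTermFun]
  rw [h4, intVec_add, show intVec m + intVec k.2 + q.1.1 = intVec m + q.1.1 + intVec k.2 by abel]
  have he := exp_two_pi_inner_intVec k.1 m
  have key : Complex.exp (Real.pi * Complex.I * ((2 * inner ℝ (intVec k.1) (intVec m + q.1.1) : ℝ) : ℂ)) *
      Complex.exp (-2 * Real.pi * Complex.I * ((inner ℝ (intVec m) q.1.2 : ℝ) : ℂ)) =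
      torusChar k q.1 * Complex.exp (-2 * Real.pi * Complex.I *
        ((inner ℝ (intVec m + intVec k.2) q.1.2 : ℝ) : ℂ)) := by
    rw [← one_mul (torusChar k q.1), ← he, torusChar, ← Complex.exp_add, ← Complex.exp_add,
      ← Complex.exp_add]
    congr 1
    simp only [inner_add_right, inner_add_left]
    push_cast
    ring
  rw [kernelFactor, zakFactor]
  linear_combination (twistPhase k.1 k.2 * weylKernel φ (intVec m + q.1.1 + intVec k.2, q.2)) * key

/-- The Weyl-Zak transform turns twisted translations into modulations. -/
theorem zakTransform_twistedTranslate (k : (Fin n → ℤ) × (Fin n → ℤ)) (φ : L2R2n n) :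
    zakTransform (twistedTranslate k.1 k.2 φ) =ᵐ[(torusMeasure n).prod volume]
      fun q => zakFactor k q * zakTransform φ q := by
  have h : zakTransform (twistedTranslate k.1 k.2 φ) =
      weightedComp (continuous_zakFactor k).aestronglyMeasurable (norm_zakFactor k)
        (MeasurePreserving.id _) (zakTransform φ) := by
    -- Unconditional summation over `ℤⁿ` absorbs the index shift.
    have h0 : HasSum (fun m => zakTerm (m + k.2) φ) (zakTransform φ) :=
      (Equiv.hasSum_iff (f := fun m => zakTerm m φ) (Equiv.addRight k.2)).2 (hasSum_zakTerm φ)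
    refine (hasSum_zakTerm (twistedTranslate k.1 k.2 φ)).unique ?_
    simp_rw [zakTerm_twistedTranslate]
    exact h0.map (weightedComp (continuous_zakFactor k).aestronglyMeasurable (norm_zakFactor k)
        (MeasurePreserving.id _)) (LinearIsometry.continuous _)
  rw [h]
  exact coeFn_weightedComp _ _ _ _

end Zak
-- The Gram matrix as the Fourier coefficients of the bracket.
section GramMatrix

variable {n : ℕ}

theorem memLp_torusChar_mul {f : Rn n × Rn n → ℂ} (hf : MemLp f 2 (torusMeasure n))
    (j : (Fin n → ℤ) × (Fin n → ℤ)) :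
    MemLp (fun p => torusChar j p * f p) 2 (torusMeasure n) := by
  refine hf.of_le ((continuous_torusChar j).aestronglyMeasurable.mul hf.1)
    (Filter.Eventually.of_forall fun p => ?_)
  rw [norm_mul, norm_torusChar, one_mul]

/-- The Gram matrix `(ŵ(k - j))` of a weight is idempotent if and only if `w² = w` almost
everywhere. -/
theorem hasSum_torusCoeff_iff_sq_eq {w : Rn n × Rn n → ℝ} (hw : Integrable w (torusMeasure n)) :
    (∀ i j, HasSum (fun k => conj (torusCoeff (fun p => torusChar i p * (w p : ℂ)) k) *
        torusCoeff (fun p => torusChar j p * (w p : ℂ)) k)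
      (torusCoeff (fun p => torusChar j p * (w p : ℂ)) i)) ↔
      ∀ᵐ p ∂torusMeasure n, w p * w p = w p := by
  have := isProbabilityMeasure_torusMeasure n
  have hwc : Integrable (fun p => (w p : ℂ)) (torusMeasure n) := hw.ofReal
  constructor
  · intro h
    -- The entry `i = j = 0` of `G² = G` says that `ŵ` is square summable, which lifts `w` from `L¹`
    -- to `L²`.
    have hs : Summable fun k => ‖torusCoeff (fun p => (w p : ℂ)) k‖ ^ 2 := by
      have h0 := (h 0 0).summable.norm
      refine h0.congr fun k => ?_
      simp only [torusChar_zero, one_mul, norm_mul, RCLike.norm_conj, sq]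
    have hL := memLp_two_of_summable_torusCoeff hwc hs
    have hsq : Integrable (fun p => (w p : ℂ) * (w p : ℂ)) (torusMeasure n) := hL.integrable_mul hL
    have hz : (fun p => (w p : ℂ) * (w p : ℂ) - (w p : ℂ)) =ᵐ[torusMeasure n] 0 := by
      refine ae_eq_zero_of_torusCoeff_eq_zero (hsq.sub hwc) fun k => ?_
      -- Entry `(0, -k)`: the hypothesis sums the series to `ŵ(k)`, Parseval to the `k`-th
      -- coefficient of `w²`.
      have h1 := (h 0 (-k)).unique
        (hasSum_torusCoeff (memLp_torusChar_mul hL 0) (memLp_torusChar_mul hL (-k)))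
      have hb : ∀ {g : Rn n × Rn n → ℂ}, Integrable g (torusMeasure n) →
          Integrable (fun p => conj (torusChar k p) * g p) (torusMeasure n) := fun hg =>
        hg.bdd_mul (c := 1)
          (Complex.continuous_conj.comp (continuous_torusChar k)).aestronglyMeasurable
          (Filter.Eventually.of_forall fun p => by
            rw [RCLike.norm_conj, norm_torusChar])
      simp only [torusCoeff, mul_sub]
      rw [integral_sub (hb hsq) (hb hwc), sub_eq_zero]
      simp only [torusCoeff, torusChar_zero, torusChar_neg, one_mul, map_one,
        Complex.conj_ofReal] at h1
      rw [h1]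
      refine integral_congr_ae (Filter.Eventually.of_forall fun p => ?_)
      ring
    filter_upwards [hz] with p hp
    exact_mod_cast sub_eq_zero.1 hp
  · intro h i j
    have hL : MemLp (fun p => (w p : ℂ)) 2 (torusMeasure n) := by
      -- In this direction `w` takes only the values 0 and 1, hence is bounded on a probability
      -- space.
      refine MemLp.of_bound hwc.1 1 ?_
      filter_upwards [h] with p hp
      rcases IsIdempotentElem.iff_eq_zero_or_one.1 hp with h0 | h0 <;> simp [h0]
    convert hasSum_torusCoeff (memLp_torusChar_mul hL i) (memLp_torusChar_mul hL j) using 1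
    refine integral_congr_ae ?_
    filter_upwards [h] with p hp
    have hp' : (w p : ℂ) * (w p : ℂ) = w p := by exact_mod_cast hp
    rw [map_mul, Complex.conj_ofReal]
    linear_combination (-conj (torusChar i p) * torusChar j p) * hp'

/-- The bracket `[φ, φ]` as a real-valued function. -/
noncomputable def bracketWeight (φ : L2R2n n) (p : Rn n × Rn n) : ℝ :=
  ∫ η : Rn n, ‖zakTransform φ (p, η)‖ ^ 2

theorem integrable_norm_sq_zakTransform (φ : L2R2n n) :
    Integrable (fun q => ‖zakTransform φ q‖ ^ 2) ((torusMeasure n).prod volume) :=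
  (Lp.memLp (zakTransform φ)).integrable_norm_pow (by norm_num)

theorem integrable_bracketWeight (φ : L2R2n n) :
    Integrable (bracketWeight φ) (torusMeasure n) := by
  have := isProbabilityMeasure_torusMeasure n
  exact (integrable_norm_sq_zakTransform φ).integral_prod_left

/-- The Zak isometry moves the inner product to the Zak side, where both vectors are modulations of
`Z_W φ`. The modulations do not depend on `η`, so integrating over `η` first leaves the bracket. -/
theorem inner_twistedTranslate (φ : L2R2n n) (k j : (Fin n → ℤ) × (Fin n → ℤ)) :
    inner ℂ (twistedSystem φ k) (twistedSystem φ j) =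
      conj (twistPhase k.1 k.2) * twistPhase j.1 j.2 *
        torusCoeff (fun p => torusChar j p * (bracketWeight φ p : ℂ)) k := by
  have := isProbabilityMeasure_torusMeasure n
  rw [← inner_zakTransform, L2.inner_def]
  have he : (fun q => inner ℂ (zakTransform (twistedSystem φ k) q)
      (zakTransform (twistedSystem φ j) q)) =ᵐ[(torusMeasure n).prod volume]
      fun q => conj (zakFactor k q) * zakFactor j q * ((‖zakTransform φ q‖ ^ 2 : ℝ) : ℂ) := by
    filter_upwards [zakTransform_twistedTranslate k φ, zakTransform_twistedTranslate j φ]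
      with q h1 h2
    change inner ℂ (zakTransform (twistedTranslate k.1 k.2 φ) q)
      (zakTransform (twistedTranslate j.1 j.2 φ) q) = _
    rw [h1, h2, RCLike.inner_apply, map_mul]
    have := Complex.mul_conj' (zakTransform φ q)
    push_cast
    linear_combination (conj (zakFactor k q) * zakFactor j q) * this
  rw [integral_congr_ae he, integral_prod _ ((L2.integrable_inner _ _).congr he), torusCoeff,
    ← integral_const_mul]
  refine integral_congr_ae (Filter.Eventually.of_forall fun p => ?_)
  simp only [zakFactor]
  rw [integral_const_mul, integral_complex_ofReal, bracketWeight, map_mul]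
  ring

theorem isParsevalFrame_iff_bracketWeight_sq (φ : L2R2n n) :
    IsParsevalFrame (principalSpace φ) (twistedSystem φ) ↔
      ∀ᵐ p ∂torusMeasure n, bracketWeight φ p * bracketWeight φ p = bracketWeight φ p := by
  rw [principalSpace, isParsevalFrame_closure_span_iff,
    ← hasSum_torusCoeff_iff_sq_eq (integrable_bracketWeight φ)]
  refine forall_congr' fun i => forall_congr' fun j => ?_
  have hu : ∀ k : (Fin n → ℤ) × (Fin n → ℤ), twistPhase k.1 k.2 ≠ 0 := fun k =>
    norm_ne_zero_iff.1 (by rw [norm_twistPhase]; exact one_ne_zero)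
  have hc : conj (twistPhase i.1 i.2) * twistPhase j.1 j.2 ≠ 0 :=
    mul_ne_zero ((map_ne_zero _).2 (hu i)) (hu j)
  rw [inner_twistedTranslate]
  -- The phases of `i` and `j` are common to all terms and to the sum; those of the summation index
  -- `k` cancel in each term.
  refine Iff.trans ?_ (hasSum_mul_left_iff hc)
  refine iff_of_eq (congrArg (fun f => HasSum f _) (funext fun k => ?_))
  rw [← inner_conj_symm (twistedSystem φ i), inner_twistedTranslate, inner_twistedTranslate]
  have h1 : twistPhase k.1 k.2 * conj (twistPhase k.1 k.2) = 1 := by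
    rw [Complex.mul_conj', norm_twistPhase]
    simp
  simp only [map_mul (starRingEnd ℂ) (_ * _), map_mul (starRingEnd ℂ) (conj _), Complex.conj_conj]
  linear_combination (conj (twistPhase i.1 i.2) * twistPhase j.1 j.2 *
    conj (torusCoeff (fun p => torusChar i p * (bracketWeight φ p : ℂ)) k) *
    torusCoeff (fun p => torusChar j p * (bracketWeight φ p : ℂ)) k) * h1

theorem bracket_self (φ : L2R2n n) (p : Rn n × Rn n) :
    bracket φ φ p = (bracketWeight φ p : ℂ) := by
  rw [bracket, bracketWeight, ← integral_complex_ofReal]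
  refine integral_congr_ae (Filter.Eventually.of_forall fun η => ?_)
  simp only [Complex.mul_conj', Complex.ofReal_pow]

/-- Almost every slice is square integrable by Fubini, so the default value 0 of `fiberMap` matters
only on a null set. -/
theorem norm_fiberMap_sq (φ : L2R2n n) :
    ∀ᵐ p ∂torusMeasure n, ‖fiberMap φ p‖ ^ 2 = bracketWeight φ p := by
  have := isProbabilityMeasure_torusMeasure n
  filter_upwards [(integrable_norm_sq_zakTransform φ).prod_right_ae] with p hp
  have hm : MemLp (fun η => zakTransform φ (p, η)) 2 volume :=
    (memLp_two_iff_integrable_sq_norm ((Lp.stronglyMeasurable (zakTransform φ)).comp_measurable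
      measurable_prodMk_left).aestronglyMeasurable).2 hp
  have h1 : inner ℂ (fiberMap φ p) (fiberMap φ p) = (bracketWeight φ p : ℂ) := by
    rw [fiberMap, dif_pos hm, L2.inner_def, bracketWeight, ← integral_complex_ofReal]
    refine integral_congr_ae ?_
    filter_upwards [hm.coeFn_toLp] with η hη
    rw [hη, inner_self_eq_norm_sq_to_K]
    simp
  refine Complex.ofReal_injective (h1.symm.trans ?_).symm
  rw [inner_self_eq_norm_sq_to_K]
  simp

theorem ae_mem_unitCube (n : ℕ) : ∀ᵐ p ∂torusMeasure n, p ∈ unitCube n ×ˢ unitCube n := by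
  rw [torusMeasure, Measure.prod_restrict]
  exact ae_restrict_mem ((measurableSet_unitCube n).prod (measurableSet_unitCube n))

end GramMatrix

end TwistedShift

theorem mainTheorem7 (n : ℕ) (φ : TwistedShift.L2R2n n) :
    TwistedShift.IsParsevalFrame (TwistedShift.principalSpace φ) (TwistedShift.twistedSystem φ) ↔
      ∀ᵐ p ∂(TwistedShift.torusMeasure n),
        p ∈ TwistedShift.bracketSupport φ → ‖TwistedShift.fiberMap φ p‖ = 1 := by
  rw [TwistedShift.isParsevalFrame_iff_bracketWeight_sq]
  refine Filter.eventually_congr ?_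
  filter_upwards [TwistedShift.ae_mem_unitCube n, TwistedShift.norm_fiberMap_sq φ] with p hp hw
  have h1 : ‖TwistedShift.fiberMap φ p‖ = 1 ↔ TwistedShift.bracketWeight φ p = 1 := by
    rw [← hw, pow_eq_one_iff_of_nonneg (norm_nonneg _) two_ne_zero]
  have h2 : p ∈ TwistedShift.bracketSupport φ ↔ TwistedShift.bracketWeight φ p ≠ 0 := by
    simp only [TwistedShift.bracketSupport, Set.mem_ofPred_eq, hp, true_and,
      TwistedShift.bracket_self, ne_eq, Complex.ofReal_eq_zero]
  -- A real idempotent is 0 or 1, that is, nonzero implies equal to 1.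
  rw [h1, h2, ← isIdempotentElem_iff, IsIdempotentElem.iff_eq_zero_or_one, or_iff_not_imp_left]
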